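/- Let $d\ge 1$, let $\mathcal F$ be the set of probability densities on $\mathbb R^d$ with respect to Lebesgue measure, $\|g\|_\infty=\sup_x|g(x)|$, and let $f_0\in\mathcal F$ and $\lambda>0$. Write $S_{\lambda'}=\{x: f_0(x)\ge\lambda'\}$. Assume 1. $f_0$ is continuous and $f_0(x)\to0$ as $\|x\|\to\infty$; 2. there are constants $C,\bar\epsilon>0$ with $\int_{\{|f_0-\lambda|\le\epsilon\}}f_0(x)\,dx\le C\epsilon$ for all $\epsilon\in(0,\bar\epsilon)$; 3. for the same $\bar\epsilon$, for all $\lambda_l<\lambda_h$ in $[\lambda-\bar\epsilon,\lambda+\bar\epsilon]$ and $x,y\in S_{\lambda_h}$: if $x,y$ lie in different connected components of $S_{\lambda_h}$ then they lie in different connected components of $S_{\lambda_l}$, and if they lie in the same connected component of $S_{\lambda_l}$ then they lie in the same connected component of $S_{\lambda_h}$. *Clusterings.* A sub-partition of $\mathcal X_n=\{x_1,\dots,x_n\}$ is a partition of a subset $A\subseteq\mathcal X_n$ of *active* points. For $f\in\mathcal F$ let $A_f=\{x_i: f(x_i)\ge\lambda\}$. The level-$\lambda$ clustering $\psi_\lambda(f)$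 is the partition of $A_f$ according to the connected components of $\{f\ge\lambda\}$; the surrogate clustering $\tilde\psi_{\delta,\lambda}(f)$ is the partition of $A_f$ into the connected components of the graph on $A_f$ that joins $x\ne x'$ when $\|x-x'\|<\delta$. For sub-partitions $\mathbf C,\mathbf C'$ with active sets $A,A'$ and cluster labels $c_i,c_i'$, let $$L_{\text{IA-Binder}}(\mathbf C,\mathbf C')=(n-1)\big(m_{ai}|A\setminus A'|+m_{ia}|A'\setminus A|\big)+\sum_{i<j,\ x_i,x_j\in A\cap A'}\big(a\,1\{c_i=c_j,\,c_i'\ne c_j'\}+b\,1\{c_i\ne c_j,\,c'_i=c'_j\}\big),$$ where $0<a=b\le1$, $m_{ai}=m_{ia}=m\le1$ and $a\le 2m$. *Estimator.* Let $\mathcal F$ carry a $\sigma$-algebra for which all evaluations $f\mapsto f(x)$ are measurable, and let $P_M(\cdot\mid\mathcal X_n)$ be, for each $n$ and each data set of size $n$, a probability distribution on $\mathcal F$ (the posterior of a Bayesian model $M$; no other property of $M$ is used). A BALLET estimate with scale $\delta$ is any minimizer $\hat{\mathbf C}_n$, over all sub-partitions $\mathbf C'$ of $\mathcal X_n$, of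 $E_{f\sim P_M(\cdot\mid\mathcal X_n)}\,L_{\text{IA-Binder}}\{\tilde\psi_{\delta,\lambda}(f),\mathbf C'\}$. *Scale.* Let $r_n=2\big(\frac{16\,d\ln n}{n\lambda v_d}\big)^{1/d}$, with $v_d$ the volume of the unit ball of $\mathbb R^d$. For $k\in\mathbb N$, $\gamma\in[0,1)$ and an estimate $\hat f$ of $f_0$ computed from $\mathcal X_n$, let $\hat\delta$ be the $(1-\gamma)$-quantile of the $k$-nearest neighbor distances $\delta_k(x_i)=\inf\{r>0:|B(x_i,r)\cap\mathcal X_n|\ge k\}$ over $x_i\in A_{\hat f}$. **Claim.** There is a constant $\bar\delta>0$ depending only on $f_0$ and $\lambda$ such that the following holds. Let $x_1,x_2,\dots$ be drawn independently from $f_0$, and let the posterior contract around $f_0$ in sup-norm: there is a sequence $\epsilon_n\ge0$, $\epsilon_n\to0$, such that $P_M(f:\|f-f_0\|_\infty\ge\epsilon_nK_n\mid\mathcal X_n)\to0$ in probability for every non-negative sequence $K_n\to\infty$. Let the scale be either * non-random, $\delta=\delta_n$ with $\delta_n\in[r_n,\bar\delta)$ for all large $n$ (in particular, any fixed $\delta\in(0,\bar\delta)$),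 or * $\delta=\hat\delta$ with a fixed $\gamma\in[0,1)$ and non-random $k=k_n$ such that $\log n\ll k\ll n$, where, with probability tending to one, $\|\hat f-f_0\|_\infty\le\lambda/2$ and $A_{\hat f}\neq\emptyset$ (the latter being required only when $A_{f_0}\ne\emptyset$). Then $\binom n2^{-1}L_{\text{IA-Binder}}\{\hat{\mathbf C}_n,\psi_\lambda(f_0)\}\to0$ in probability as $n\to\infty$. -/

import Mathlib

open MeasureTheory ProbabilityTheory Filter Topology
open scoped ENNReal Classical

noncomputable section

namespace Ballet

/-- The sample space `ℝ^d` with its Euclidean norm. -/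
abbrev E (d : ℕ) : Type := EuclideanSpace ℝ (Fin d)

/-- The space of probability densities on `ℝ^d` with respect to Lebesgue measure
(actual functions, not classes up to null sets). -/
structure Density (d : ℕ) where
  toFun : E d → ℝ
  measurable' : Measurable toFun
  nonneg' : ∀ x, 0 ≤ toFun x
  lintegral_eq_one' : ∫⁻ x, ENNReal.ofReal (toFun x) = 1

instance (d : ℕ) : CoeFun (Density d) (fun _ => E d → ℝ) := ⟨Density.toFun⟩

/-- The probability measure `f(x) dx`. -/
def Density.law {d : ℕ} (f : Density d) : Measure (E d) :=
  volume.withDensity (fun x => ENNReal.ofReal (f x))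

/-- The sup-norm distance `sup_x |f x - g x|`, with values in `[0, ∞]`. -/
def supDist {d : ℕ} (f g : E d → ℝ) : ℝ≥0∞ := ⨆ x, ENNReal.ofReal |f x - g x|

/-- The level set `{x : f x ≥ lam}`. -/
def levelSet {d : ℕ} (f : E d → ℝ) (lam : ℝ) : Set (E d) := {x | lam ≤ f x}

/-- `x` and `y` are connected in `S`: both lie in one topological connected component of `S`. -/
def ConnectedIn {d : ℕ} (S : Set (E d)) (x y : E d) : Prop := y ∈ connectedComponentIn S x

/-! ### Sub-partitions of the data

A data set is a tuple `x : Fin n → E d`. Points are referred to by their indices. -/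

/-- Sub-partitions: a set of active (indices of) points and a partition of that set. -/
abbrev SubPartition (n : ℕ) : Type := (A : Finset (Fin n)) × Finpartition A

/-- The active points of a sub-partition. -/
abbrev SubPartition.active {n : ℕ} (C : SubPartition n) : Finset (Fin n) := C.1

/-- For active `i` and `j`: they lie in the same cluster. -/
def SubPartition.Same {n : ℕ} (C : SubPartition n) (i j : Fin n) : Prop :=
  C.2.part i = C.2.part j

/-- The active data points `{i : f (x i) ≥ lam}` of `f`. -/
def activeSet {d n : ℕ} (f : E d → ℝ) (lam : ℝ) (x : Fin n → E d) : Finset (Fin n) :=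
  Finset.univ.filter (fun i => lam ≤ f (x i))

/-- The level-`lam` clustering: the active points are grouped by the topological connected
components of the level set. -/
def levelClustering {d n : ℕ} (lam : ℝ) (f : E d → ℝ) (x : Fin n → E d) : SubPartition n :=
  ⟨activeSet f lam x,
    Finpartition.ofSetSetoid
      (Setoid.ker (fun i => connectedComponentIn (levelSet f lam) (x i))) (activeSet f lam x)⟩

/-- The `δ`-neighborhood graph on the points with index in `A` (indices outside `A` are left
isolated and play no role). -/
def nbhdGraph {d n : ℕ} (δ : ℝ) (x : Fin n → E d) (A : Finset (Fin n)) : SimpleGraph (Fin n) where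
  Adj i j := i ≠ j ∧ i ∈ A ∧ j ∈ A ∧ ‖x i - x j‖ < δ
  symm := ⟨fun i j h => ⟨h.1.symm, h.2.2.1, h.2.1, by rw [norm_sub_rev]; exact h.2.2.2⟩⟩
  loopless := ⟨fun _ h => h.1 rfl⟩

/-- The surrogate clustering: the active points are grouped by the connected components of their
`δ`-neighborhood graph. -/
def surrogateClustering {d n : ℕ} (δ lam : ℝ) (f : E d → ℝ) (x : Fin n → E d) : SubPartition n :=
  ⟨activeSet f lam x,
    Finpartition.ofSetSetoid (nbhdGraph δ x (activeSet f lam x)).reachableSetoid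
      (activeSet f lam x)⟩

/-- The Inactive/Active Binder loss with parameters `a, b, mai, mia`. -/
def iaBinderLoss {n : ℕ} (a b mai mia : ℝ) (C C' : SubPartition n) : ℝ :=
  ((n : ℝ) - 1) * (mai * ((C.active \ C'.active).card : ℝ)
      + mia * ((C'.active \ C.active).card : ℝ))
    + ∑ p ∈ (Finset.univ : Finset (Fin n × Fin n)).filter (fun p => p.1 < p.2 ∧
          p.1 ∈ C.active ∩ C'.active ∧ p.2 ∈ C.active ∩ C'.active),
        (a * (if C.Same p.1 p.2 ∧ ¬ C'.Same p.1 p.2 then 1 else 0)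
          + b * (if ¬ C.Same p.1 p.2 ∧ C'.Same p.1 p.2 then 1 else 0))

/-! ### The estimator -/

/-- Expected loss of the sub-partition `C'` when `f` is drawn from `Q`. -/
def risk {d n : ℕ} [MeasurableSpace (Density d)] (a b mai mia δ lam : ℝ)
    (Q : Measure (Density d)) (x : Fin n → E d) (C' : SubPartition n) : ℝ :=
  ∫ f : Density d, iaBinderLoss a b mai mia (surrogateClustering δ lam f x) C' ∂Q

/-- `C` is a BALLET estimate: a minimizer of the expected loss over all sub-partitions. -/
def IsBallet {d n : ℕ} [MeasurableSpace (Density d)] (a b mai mia δ lam : ℝ)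
    (Q : Measure (Density d)) (x : Fin n → E d) (C : SubPartition n) : Prop :=
  ∀ C' : SubPartition n, risk a b mai mia δ lam Q x C ≤ risk a b mai mia δ lam Q x C'

/-! ### The scale parameter `δ` -/

/-- `r_n = 2 (16 d log n / (n lam v_d)) ^ (1/d)`, where `v_d` is the volume of the unit ball. -/
def rLower (n d : ℕ) (lam : ℝ) : ℝ :=
  2 * (16 * d * Real.log n
    / (n * lam * (volume (Metric.ball (0 : E d) 1)).toReal)) ^ (1 / (d : ℝ))

/-- `k`-nearest neighbor distance: the infimum of the `r > 0` such that the open ball `B(y, r)`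
contains at least `k` data points. -/
def knnDist {d n : ℕ} (k : ℕ) (x : Fin n → E d) (y : E d) : ℝ :=
  sInf {r : ℝ | 0 < r ∧
    k ≤ ((Finset.univ : Finset (Fin n)).filter (fun j => x j ∈ Metric.ball y r)).card}

/-- The `p`-quantile of the finite family `v i`, `i ∈ A`: the least `t` such that at least the
fraction `p` of the family is `≤ t`. (Meaningful for nonempty `A` and `0 < p ≤ 1`.) -/
def quantile {ι : Type*} (p : ℝ) (A : Finset ι) (v : ι → ℝ) : ℝ :=
  sInf {t : ℝ | p * (A.card : ℝ) ≤ ((A.filter (fun i => v i ≤ t)).card : ℝ)}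

/-- The data-adaptive scale: the `(1 - γ)`-quantile of the `k`-nearest neighbor distances of the
points that are active for the density estimate `fhat`. -/
def deltaHat {d n : ℕ} (k : ℕ) (γ lam : ℝ) (fhat : E d → ℝ) (x : Fin n → E d) : ℝ :=
  quantile (1 - γ) (activeSet fhat lam x) (fun i => knnDist k x (x i))

/-! ### Assumptions -/

/-- Fast mass decay around the level `lam`, with constants `C` and `εbar`. -/
def FastMassDecay {d : ℕ} (f₀ : E d → ℝ) (lam C εbar : ℝ) : Prop :=
  ∀ ε : ℝ, 0 < ε → ε < εbar → ∫ x in {x | |f₀ x - lam| ≤ ε}, f₀ x ≤ C * ε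

/-- Stable connected components: components of level sets neither merge nor split for levels in
`[lam - εbar, lam + εbar]`. -/
def StableComponents {d : ℕ} (f₀ : E d → ℝ) (lam εbar : ℝ) : Prop :=
  ∀ l h : ℝ, lam - εbar ≤ l → l < h → h ≤ lam + εbar →
    ∀ x ∈ levelSet f₀ h, ∀ y ∈ levelSet f₀ h,
      (¬ ConnectedIn (levelSet f₀ h) x y → ¬ ConnectedIn (levelSet f₀ l) x y) ∧
      (ConnectedIn (levelSet f₀ l) x y → ConnectedIn (levelSet f₀ h) x y)

/-- The first `n` observations. -/
def sample {Ω : Type*} {d : ℕ} (X : ℕ → Ω → E d) (n : ℕ) (ω : Ω) : Fin n → E d :=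
  fun i => X i ω

/-- Posterior contraction around `f₀` in the sup-norm: for some rate `ε n → 0`, the posterior mass
of `{f : ‖f - f₀‖ ≥ ε n * K n}` tends to zero in probability for every `K n → ∞`. Here `post n x`
is the posterior distribution given the data set `x` of size `n`. -/
def PosteriorContracts {Ω : Type*} [MeasurableSpace Ω] (P : Measure Ω) {d : ℕ}
    [MeasurableSpace (Density d)] (X : ℕ → Ω → E d)
    (post : (n : ℕ) → (Fin n → E d) → Measure (Density d)) (f₀ : Density d) : Prop :=
  ∃ ε : ℕ → ℝ, (∀ n, 0 ≤ ε n) ∧ Tendsto ε atTop (𝓝 0) ∧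
    ∀ K : ℕ → ℝ, (∀ n, 0 ≤ K n) → Tendsto K atTop atTop →
      TendstoInMeasure P
        (fun n ω => (post n (sample X n ω)).real
          {f : Density d | ENNReal.ofReal (ε n * K n) ≤ supDist f f₀})
        atTop (fun _ => (0 : ℝ))

/-- Admissible non-random scale: `δ` does not depend on the data, and `δ n ∈ [r_n, δbar)` for all
large `n`. -/
def DeterministicScale {d : ℕ} (lam δbar : ℝ) (δ : (n : ℕ) → (Fin n → E d) → ℝ) : Prop :=
  ∃ s : ℕ → ℝ, (∀ n x, δ n x = s n) ∧ ∀ᶠ n in atTop, s n ∈ Set.Ico (rLower n d lam) δbar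

/-- Data-adaptive scale: `δ` is the data-adaptive scale for some `γ ∈ [0, 1)`,
`log n ≪ k n ≪ n`, and an estimate `fhat` of `f₀` such that, with probability tending to one,
`‖fhat - f₀‖ ≤ lam / 2` and there are active points for `fhat` (so that the quantile is
defined) unless there are none for `f₀` itself. -/
def AdaptiveScale {Ω : Type*} [MeasurableSpace Ω] (P : Measure Ω) {d : ℕ} (X : ℕ → Ω → E d)
    (f₀ : Density d) (lam : ℝ) (δ : (n : ℕ) → (Fin n → E d) → ℝ) : Prop :=
  ∃ (γ : ℝ) (k : ℕ → ℕ) (fhat : (n : ℕ) → (Fin n → E d) → E d → ℝ),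
    0 ≤ γ ∧ γ < 1 ∧
    (fun n : ℕ => Real.log n) =o[atTop] (fun n : ℕ => (k n : ℝ)) ∧
    (fun n : ℕ => (k n : ℝ)) =o[atTop] (fun n : ℕ => (n : ℝ)) ∧
    Tendsto (fun n => P {ω | ¬ (supDist (fhat n (sample X n ω)) f₀ ≤ ENNReal.ofReal (lam / 2) ∧
      ((activeSet f₀ lam (sample X n ω)).Nonempty →
        (activeSet (fhat n (sample X n ω)) lam (sample X n ω)).Nonempty))}) atTop (𝓝 0) ∧
    ∀ n x, δ n x = deltaHat (k n) γ lam (fhat n x) x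

end Ballet

end

/-! For `a = b ≤ 2m` the loss is symmetric and satisfies the triangle inequality, because both hold
for each pair of points (`pairLoss_triangle`). Averaging the triangle inequality through the
surrogate clustering of a posterior draw, and using minimality of the estimate, bounds its loss
against the true level clustering by twice the posterior expected loss of the true clustering itself
(`ballet_loss_le`). It remains to show that the true clustering has small posterior risk.

Fix `η > 0`. Draws with sup-distance at least `η` from `f₀` have vanishing posterior mass, and the
loss never exceeds `n(n-1)`. For the other draws the comparison is deterministic
(`surrogate_loss_le`): on suitable data the two clusterings agree off the strip `|f₀ - lam| ≤ 2η`.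
Short steps between active points cannot leave a slightly lower level set, so stability of
components forbids false merging. Conversely, data that cover the level set densely chain together
any two points of one component of a slightly higher level set, so stability forbids false
splitting. By mass decay and the law of large numbers, the strip holds a fraction `O(η)` of the
data. Since `η` is arbitrary but fixed, no contraction rate is needed.

The remaining input is probabilistic. A union bound over a net shows that balls of radius slightly
below `r_n / 2` around all points of the level set contain data (`tendsto_measure_uncovered`).
Similar net arguments place all relevant nearest neighbor distances, hence the adaptive scale,
between `r_n` and `δbar` (`tendsto_measure_bad_scale`). -/

noncomputable section

namespace Ballet

/-! ### The loss as a sum over pairs -/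

/-- The pairs `i < j` of indices. -/
def pairs (n : ℕ) : Finset (Fin n × Fin n) := Finset.univ.filter (fun p => p.1 < p.2)

/-- `1` if exactly one of the two sub-partitions has `i` active, else `0`. -/
def activeDiff {n : ℕ} (C C' : SubPartition n) (i : Fin n) : ℝ :=
  if i ∈ C.active ↔ i ∈ C'.active then 0 else 1

/-- The contribution of the pair `p` to the loss with parameters `a = b` and `mai = mia = m`. -/
def pairLoss {n : ℕ} (a m : ℝ) (C C' : SubPartition n) (p : Fin n × Fin n) : ℝ :=
  m * (activeDiff C C' p.1 + activeDiff C C' p.2) +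
    a * (if (p.1 ∈ C.active ∧ p.1 ∈ C'.active ∧ p.2 ∈ C.active ∧ p.2 ∈ C'.active) ∧
      ¬ (C.Same p.1 p.2 ↔ C'.Same p.1 p.2) then 1 else 0)

/-- Each index lies in exactly `n - 1` pairs. This turns the factor `n - 1` of the activity terms
into a sum over pairs, so that the loss can be studied one pair at a time. -/
lemma sum_pairs_add {n : ℕ} (g : Fin n → ℝ) :
    ∑ p ∈ pairs n, (g p.1 + g p.2) = ((n : ℝ) - 1) * ∑ i, g i := by
  have hswap : ∑ p ∈ pairs n, g p.2 =
      ∑ p ∈ (Finset.univ : Finset (Fin n × Fin n)).filter (fun p => p.2 < p.1), g p.1 := by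
    refine Finset.sum_nbij' Prod.swap Prod.swap ?_ ?_ ?_ ?_ ?_ <;> simp [pairs]
  have hdisj : Disjoint (pairs n)
      ((Finset.univ : Finset (Fin n × Fin n)).filter (fun p => p.2 < p.1)) := by
    rw [Finset.disjoint_left]
    rintro ⟨i, j⟩ h h'
    simp only [pairs, Finset.mem_filter, Finset.mem_univ, true_and] at h h'
    exact absurd h (not_lt.2 h'.le)
  have hunion : pairs n ∪ (Finset.univ : Finset (Fin n × Fin n)).filter (fun p => p.2 < p.1)
      = Finset.univ.filter (fun p => p.1 ≠ p.2) := by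
    ext ⟨i, j⟩
    simp [pairs]
  rw [Finset.sum_add_distrib, hswap, ← Finset.sum_union hdisj, hunion, Finset.sum_filter,
    Fintype.sum_prod_type, Finset.mul_sum]
  refine Finset.sum_congr rfl fun i _ => ?_
  simp only
  rw [← Finset.sum_filter, Finset.sum_const, Finset.filter_ne, Finset.card_erase_of_mem (by simp),
    Finset.card_univ, Fintype.card_fin, nsmul_eq_mul, Nat.cast_sub (by have := i.2; omega)]
  simp

lemma card_pairs (n : ℕ) : 2 * ((pairs n).card : ℝ) = n * ((n : ℝ) - 1) := by
  have h := sum_pairs_add (n := n) (fun _ => 1)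
  simp only [Finset.sum_const, Finset.card_univ, Fintype.card_fin, nsmul_eq_mul] at h
  linarith

lemma iaBinderLoss_eq_sum {n : ℕ} (a m : ℝ) (C C' : SubPartition n) :
    iaBinderLoss a a m m C C' = ∑ p ∈ pairs n, pairLoss a m C C' p := by
  have h1 : ∑ i, activeDiff C C' i =
      ((C.active \ C'.active).card : ℝ) + ((C'.active \ C.active).card : ℝ) := by
    rw [Finset.card_eq_sum_ones, Finset.card_eq_sum_ones, Nat.cast_sum, Nat.cast_sum,
      ← Finset.sum_subset (Finset.subset_univ (C.active \ C'.active ∪ C'.active \ C.active)),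
      Finset.sum_union disjoint_sdiff_sdiff]
    · congr 1 <;>
      · refine Finset.sum_congr rfl fun i hi => ?_
        rw [Finset.mem_sdiff] at hi
        simp [activeDiff, hi.1, hi.2]
    · intro i _ hi
      simp only [Finset.mem_union, Finset.mem_sdiff] at hi
      simp only [activeDiff]
      rw [if_pos (by tauto)]
  simp only [pairLoss]
  rw [Finset.sum_add_distrib, ← Finset.mul_sum, sum_pairs_add, h1, iaBinderLoss]
  congr 1
  · ring
  · rw [pairs, Finset.sum_filter, Finset.sum_filter]
    refine Finset.sum_congr rfl fun p _ => ?_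
    simp only [Finset.mem_inter]
    split_ifs <;> first | tauto | simp

/-! ### Metric properties and bounds of the loss -/

section Bounds

variable {n : ℕ} {a m : ℝ}

lemma activeDiff_comm (C C' : SubPartition n) (i : Fin n) :
    activeDiff C C' i = activeDiff C' C i := by
  simp only [activeDiff]; congr 1; rw [iff_comm]

lemma pairLoss_comm (C C' : SubPartition n) (p : Fin n × Fin n) :
    pairLoss a m C C' p = pairLoss a m C' C p := by
  simp only [pairLoss, activeDiff_comm C C']
  congr 2
  exact if_congr (by tauto) rfl rfl

lemma activeDiff_triangle (C₁ C₂ C₃ : SubPartition n) (i : Fin n) :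
    activeDiff C₁ C₃ i ≤ activeDiff C₁ C₂ i + activeDiff C₂ C₃ i := by
  simp only [activeDiff]
  split_ifs <;> first | (exfalso; tauto) | norm_num

/-- The only delicate case is a clustering disagreement between `C₁` and `C₃` on a pair active in
both. If the pair is active in `C₂`, then `C₂` disagrees with one of them. Otherwise some point of
the pair is inactive in `C₂`, and its activity cost `m` is paid on both legs; this is where `a ≤ 2 *
m` enters. -/
lemma pairLoss_triangle (ha : 0 < a) (ham : a ≤ 2 * m) (C₁ C₂ C₃ : SubPartition n)
    (p : Fin n × Fin n) :
    pairLoss a m C₁ C₃ p ≤ pairLoss a m C₁ C₂ p + pairLoss a m C₂ C₃ p := by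
  have hm : 0 < m := by linarith
  have t1 := mul_le_mul_of_nonneg_left (activeDiff_triangle C₁ C₂ C₃ p.1) hm.le
  have t2 := mul_le_mul_of_nonneg_left (activeDiff_triangle C₁ C₂ C₃ p.2) hm.le
  by_cases h13 : (p.1 ∈ C₁.active ∧ p.1 ∈ C₃.active ∧ p.2 ∈ C₁.active ∧ p.2 ∈ C₃.active) ∧
      ¬ (C₁.Same p.1 p.2 ↔ C₃.Same p.1 p.2)
  · obtain ⟨⟨h1, h3, k1, k3⟩, hs⟩ := h13
    by_cases h2 : p.1 ∈ C₂.active <;> by_cases k2 : p.2 ∈ C₂.active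
    · have : ¬ (C₁.Same p.1 p.2 ↔ C₂.Same p.1 p.2) ∨ ¬ (C₂.Same p.1 p.2 ↔ C₃.Same p.1 p.2) := by
        tauto
      simp only [pairLoss, activeDiff, h1, h2, h3, k1, k2, k3, hs, true_and]
      split_ifs <;> first | (exfalso; tauto) | (norm_num; try linarith)
    all_goals
      simp only [pairLoss, activeDiff, h1, h2, h3, k1, k2, k3, hs]
      norm_num
      linarith
  · simp only [pairLoss]
    rw [if_neg h13]
    split_ifs <;> linarith

lemma pairLoss_nonneg (ha : 0 < a) (hm : 0 < m) (C C' : SubPartition n) (p : Fin n × Fin n) :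
    0 ≤ pairLoss a m C C' p := by
  simp only [pairLoss, activeDiff]
  split_ifs <;> linarith

/-- A clustering disagreement excludes activity differences, so the cost is at most `max a (2 * m)`.
-/
lemma pairLoss_le_two (ha : a ≤ 1) (hm : m ≤ 1) (C C' : SubPartition n) (p : Fin n × Fin n) :
    pairLoss a m C C' p ≤ 2 := by
  by_cases h : (p.1 ∈ C.active ∧ p.1 ∈ C'.active ∧ p.2 ∈ C.active ∧ p.2 ∈ C'.active) ∧
      ¬ (C.Same p.1 p.2 ↔ C'.Same p.1 p.2)
  · simp only [pairLoss, activeDiff, h.1]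
    split_ifs <;> norm_num <;> linarith
  · simp only [pairLoss, activeDiff]
    rw [if_neg h]
    split_ifs <;> linarith

lemma iaBinderLoss_comm (C C' : SubPartition n) :
    iaBinderLoss a a m m C C' = iaBinderLoss a a m m C' C := by
  simp only [iaBinderLoss_eq_sum, pairLoss_comm C C']

lemma iaBinderLoss_triangle (ha : 0 < a) (ham : a ≤ 2 * m) (C₁ C₂ C₃ : SubPartition n) :
    iaBinderLoss a a m m C₁ C₃ ≤ iaBinderLoss a a m m C₁ C₂ + iaBinderLoss a a m m C₂ C₃ := by
  simp only [iaBinderLoss_eq_sum, ← Finset.sum_add_distrib]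
  exact Finset.sum_le_sum fun p _ => pairLoss_triangle ha ham _ _ _ p

lemma iaBinderLoss_nonneg (ha : 0 < a) (hm : 0 < m) (C C' : SubPartition n) :
    0 ≤ iaBinderLoss a a m m C C' := by
  rw [iaBinderLoss_eq_sum]
  exact Finset.sum_nonneg fun p _ => pairLoss_nonneg ha hm _ _ p

lemma iaBinderLoss_le (ha : a ≤ 1) (hm : m ≤ 1) (C C' : SubPartition n) :
    iaBinderLoss a a m m C C' ≤ n * ((n : ℝ) - 1) := by
  rw [iaBinderLoss_eq_sum, ← card_pairs]
  refine (Finset.sum_le_card_nsmul _ _ 2 fun p _ => pairLoss_le_two ha hm _ _ p).trans ?_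
  rw [nsmul_eq_mul, mul_comm]

/-- If two sub-partitions agree outside the index set `B`, then their loss is at most
`2 (n - 1) |B|`. -/
lemma iaBinderLoss_le_of_agree (ha : a ≤ 1) (hm : m ≤ 1) (C C' : SubPartition n)
    (B : Finset (Fin n)) (hact : ∀ i ∉ B, (i ∈ C.active ↔ i ∈ C'.active))
    (hsame : ∀ i ∉ B, ∀ j ∉ B, i ∈ C.active → i ∈ C'.active → j ∈ C.active → j ∈ C'.active →
      (C.Same i j ↔ C'.Same i j)) :
    iaBinderLoss a a m m C C' ≤ ((n : ℝ) - 1) * (2 * B.card) := by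
  have hB : ∑ i, (if i ∈ B then (2 : ℝ) else 0) = 2 * B.card := by
    rw [Finset.sum_ite_mem, Finset.univ_inter, Finset.sum_const, nsmul_eq_mul, mul_comm]
  -- A pair costs at most 2, and only if it meets `B`; the cost is charged to its endpoints in `B`.
  rw [iaBinderLoss_eq_sum, ← hB, ← sum_pairs_add]
  refine Finset.sum_le_sum fun p _ => ?_
  have h2 := pairLoss_le_two ha hm C C' p
  by_cases h : p.1 ∈ B
  · by_cases h' : p.2 ∈ B <;> simp only [h, h', if_true, if_false] <;> linarith
  by_cases h' : p.2 ∈ B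
  · simp only [h, h', if_true, if_false]; linarith
  have hn : ¬ ((p.1 ∈ C.active ∧ p.1 ∈ C'.active ∧ p.2 ∈ C.active ∧ p.2 ∈ C'.active) ∧
      ¬ (C.Same p.1 p.2 ↔ C'.Same p.1 p.2)) := fun hc =>
    hc.2 (hsame _ h _ h' hc.1.1 hc.1.2.1 hc.1.2.2.1 hc.1.2.2.2)
  simp only [pairLoss, activeDiff]
  rw [if_neg hn, if_pos (hact _ h), if_pos (hact _ h'), if_neg h, if_neg h']
  simp

end Bounds

/-! ### The surrogate and the level set clusterings -/

lemma surrogateClustering_same {d n : ℕ} {δ lam : ℝ} {f : E d → ℝ} {x : Fin n → E d} {i j : Fin n}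
    (hi : i ∈ activeSet f lam x) (hj : j ∈ activeSet f lam x) :
    (surrogateClustering δ lam f x).Same i j ↔
      (nbhdGraph δ x (activeSet f lam x)).Reachable i j := by
  unfold SubPartition.Same
  constructor
  · intro h
    have : j ∈ (surrogateClustering δ lam f x).2.part i := by
      rw [h]; exact Finpartition.mem_part _ hj
    exact (Finpartition.mem_part_ofSetSetoid_iff_rel _).1 this |>.2.2
  · intro h
    have : j ∈ (surrogateClustering δ lam f x).2.part i :=
      (Finpartition.mem_part_ofSetSetoid_iff_rel _).2 ⟨hi, hj, h⟩
    exact ((Finpartition.mem_part_iff_part_eq_part _ hj hi).1 this).symm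

lemma levelClustering_same {d n : ℕ} {lam : ℝ} {f : E d → ℝ} {x : Fin n → E d} {i j : Fin n}
    (hi : i ∈ activeSet f lam x) (hj : j ∈ activeSet f lam x) :
    (levelClustering lam f x).Same i j ↔ ConnectedIn (levelSet f lam) (x i) (x j) := by
  have hxj : x j ∈ levelSet f lam := (Finset.mem_filter.1 hj).2
  have key : ConnectedIn (levelSet f lam) (x i) (x j) ↔
      connectedComponentIn (levelSet f lam) (x i) = connectedComponentIn (levelSet f lam) (x j) :=
    ⟨fun h => connectedComponentIn_eq h, fun h => by
      unfold ConnectedIn; rw [h]; exact mem_connectedComponentIn hxj⟩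
  rw [key]
  unfold SubPartition.Same
  constructor
  · intro h
    have : j ∈ (levelClustering lam f x).2.part i := by
      rw [h]; exact Finpartition.mem_part _ hj
    exact (Finpartition.mem_part_ofSetSetoid_iff_rel _).1 this |>.2.2
  · intro h
    have : j ∈ (levelClustering lam f x).2.part i :=
      (Finpartition.mem_part_ofSetSetoid_iff_rel _).2 ⟨hi, hj, h⟩
    exact ((Finpartition.mem_part_iff_part_eq_part _ hj hi).1 this).symm

/-! ### Geometry of the neighborhood graph -/

section Geometry

variable {d n : ℕ} {f₀ f : E d → ℝ} {lam e η δ δbar : ℝ} {x : Fin n → E d}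

lemma abs_sub_lt_of_supDist_lt {f g : E d → ℝ} {η : ℝ}
    (h : supDist f g < ENNReal.ofReal η) (x : E d) : |f x - g x| < η := by
  have h1 : ENNReal.ofReal |f x - g x| ≤ supDist f g :=
    le_iSup (fun x => ENNReal.ofReal |f x - g x|) x
  exact (ENNReal.ofReal_lt_ofReal_iff_of_nonneg (abs_nonneg _)).1 (h1.trans_lt h)

lemma abs_sub_le_of_supDist_le {f g : E d → ℝ} {η : ℝ} (hη : 0 ≤ η)
    (h : supDist f g ≤ ENNReal.ofReal η) (x : E d) : |f x - g x| ≤ η := by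
  have h1 : ENNReal.ofReal |f x - g x| ≤ supDist f g :=
    le_iSup (fun x => ENNReal.ofReal |f x - g x|) x
  exact (ENNReal.ofReal_le_ofReal_iff hη).1 (h1.trans h)

/-- Paths with short steps between points of a slightly higher level set stay in one connected
component. -/
lemma connectedIn_of_reachable (A : Finset (Fin n)) {l : ℝ} (he : 0 < e)
    (hmod : ∀ y z, dist y z < δbar → |f₀ y - f₀ z| < e / 2) (hδ : δ ≤ δbar)
    (hA : ∀ i ∈ A, l + e / 2 ≤ f₀ (x i)) {i j : Fin n} (hi : i ∈ A)
    (h : (nbhdGraph δ x A).Reachable i j) :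
    ConnectedIn (levelSet f₀ l) (x i) (x j) := by
  have hself : ∀ i ∈ A, x i ∈ levelSet f₀ l := fun i hi => by
    have h1 := hA i hi
    change l ≤ f₀ (x i)
    linarith
  obtain ⟨w⟩ := h
  induction w with
  | nil => exact mem_connectedComponentIn (hself _ hi)
  | @cons u v w hadj _ ih =>
    have hv := ih hadj.2.2.1
    have hseg : segment ℝ (x u) (x v) ⊆ levelSet f₀ l := by
      intro y hy
      have h1 : dist (x u) y < δbar := by
        have := (convex_ball (x u) δbar).segment_subset (x := x u) (y := x v)
        have hlt : dist (x v) (x u) < δbar := by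
          rw [dist_comm, dist_eq_norm]; exact hadj.2.2.2.trans_le hδ
        have := this (Metric.mem_ball_self (dist_nonneg.trans_lt hlt)) hlt hy
        rwa [dist_comm]
      have h2 := abs_lt.1 (hmod _ _ h1)
      have h3 := hA u hi
      simp only [levelSet, Set.mem_ofPred_eq]
      linarith
    have hcomp : x v ∈ connectedComponentIn (levelSet f₀ l) (x u) :=
      (convex_segment (x u) (x v)).isPreconnected.subset_connectedComponentIn
        (left_mem_segment ℝ _ _) hseg (right_mem_segment ℝ _ _)
    unfold ConnectedIn at hv ⊢
    rwa [connectedComponentIn_eq hcomp]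

/-- If the data are dense in a level set, then points of one component of it are connected in the
neighborhood graph. -/
lemma reachable_of_connectedIn (A : Finset (Fin n)) {h ρ t : ℝ} (ht : 0 < t)
    (hρ : 2 * ρ + t ≤ δ) (hA : ∀ z, h ≤ f₀ z → ∀ i, dist (x i) z < ρ → i ∈ A)
    (hcov : ∀ z, h ≤ f₀ z → ∃ i, dist (x i) z < ρ) {i j : Fin n}
    (hi : h ≤ f₀ (x i)) (hij : ConnectedIn (levelSet f₀ h) (x i) (x j)) :
    (nbhdGraph δ x A).Reachable i j := by
  have hsub := connectedComponentIn_subset (levelSet f₀ h) (x i)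
  obtain ⟨k, hk⟩ := hcov (x i) hi
  have hρ0 : 0 < ρ := dist_nonneg.trans_lt hk
  have hloc : ∀ z z' : E d, h ≤ f₀ z → h ≤ f₀ z' → dist z z' < t → ∀ k l,
      dist (x k) z < ρ → dist (x l) z' < ρ → (nbhdGraph δ x A).Reachable k l := by
    intro z z' hz hz' hzz k l hk hl
    by_cases hkl : k = l
    · rw [hkl]
    refine SimpleGraph.Adj.reachable ⟨hkl, hA z hz k hk, hA z' hz' l hl, ?_⟩
    rw [← dist_eq_norm]
    have := dist_triangle4 (x k) z z' (x l)
    rw [dist_comm z' (x l)] at this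
    linarith
  -- The relation "all data points near `z` and near `z'` are mutually reachable" holds locally, and
  -- is transitive because a data point lies near every intermediate point. Connectedness then makes
  -- it global; no path between `x i` and `x j` is needed.
  refine IsPreconnected.induction₂' (isPreconnected_connectedComponentIn (x := x i)
    (F := levelSet f₀ h)) (fun z z' => ∀ k l, dist (x k) z < ρ → dist (x l) z' < ρ →
      (nbhdGraph δ x A).Reachable k l) ?_ ?_ (mem_connectedComponentIn hi) hij i j
      (by simpa using hρ0) (by simpa using hρ0)
  · intro z hz
    filter_upwards [self_mem_nhdsWithin, mem_nhdsWithin_of_mem_nhds (Metric.ball_mem_nhds z ht)]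
      with z' hz' hb
    exact ⟨hloc z z' (hsub hz) (hsub hz') (by rw [dist_comm]; exact hb),
      hloc z' z (hsub hz') (hsub hz) hb⟩
  · intro u v w hu hv hw huv hvw k l hk hl
    obtain ⟨p, hp⟩ := hcov v (hsub hv)
    exact (huv k p hk hp).trans (hvw p l hp hl)

/-- The indices of the data points at which `f₀` is within `η` of the level. -/
def stripSet (f₀ : E d → ℝ) (lam η : ℝ) (x : Fin n → E d) : Finset (Fin n) :=
  Finset.univ.filter (fun i => |f₀ (x i) - lam| ≤ η)

/-- On well-covered data, the surrogate clustering of a function close to `f₀` is close to the level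
set clustering of `f₀`. -/
lemma surrogate_loss_le {a m : ℝ} (ha : a ≤ 1) (hm : m ≤ 1)
    (hstab : StableComponents f₀ lam e) (he : 0 < e)
    (hmod : ∀ y z, dist y z < δbar → |f₀ y - f₀ z| < e / 2)
    (hη : 0 < η) (hηe : 2 * η ≤ e / 2) (hf : ∀ y, |f y - f₀ y| < η)
    (hδ : δ ≤ δbar) {ρ t : ℝ} (ht : 0 < t)
    (hρ : (activeSet f₀ lam x).Nonempty → 2 * ρ + t ≤ δ)
    (hmodρ : ∀ y z, dist y z < ρ → |f₀ y - f₀ z| < η)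
    (hcov : ∀ z, lam ≤ f₀ z → ∃ i, dist (x i) z < ρ) :
    iaBinderLoss a a m m (surrogateClustering δ lam f x) (levelClustering lam f₀ x) ≤
      ((n : ℝ) - 1) * (2 * (stripSet f₀ lam (2 * η) x).card) := by
  refine iaBinderLoss_le_of_agree ha hm _ _ _ ?_ ?_
  · intro i hi
    simp only [stripSet, Finset.mem_filter, Finset.mem_univ, true_and, not_le, lt_abs] at hi
    have h1 := abs_lt.1 (hf (x i))
    simp only [SubPartition.active, surrogateClustering, levelClustering, activeSet,
      Finset.mem_filter, Finset.mem_univ, true_and]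
    constructor <;> intro h <;> rcases hi with hi | hi <;> linarith
  · intro i hi j hj hi1 hi2 hj1 hj2
    have up : ∀ i ∉ stripSet f₀ lam (2 * η) x, i ∈ activeSet f₀ lam x →
        lam + 2 * η ≤ f₀ (x i) := by
      intro i hi hi2
      simp only [stripSet, activeSet, Finset.mem_filter, Finset.mem_univ, true_and, not_le,
        lt_abs] at hi hi2
      rcases hi with hi | hi <;> linarith
    have hui := up i hi hi2
    have huj := up j hj hj2
    have hli : lam ≤ f₀ (x i) := by linarith
    have hlj : lam ≤ f₀ (x j) := by linarith
    rw [surrogateClustering_same hi1 hj1, levelClustering_same hi2 hj2]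
    constructor
    · intro h
      -- Points active for `f` have `f₀ ≥ lam - η ≥ lam - e / 2`, so the chain stays in the level
      -- set at `lam - e`.
      refine (hstab (lam - e) lam le_rfl (by linarith) (by linarith) _ hli _ hlj).2 ?_
      refine connectedIn_of_reachable (activeSet f lam x) he hmod hδ (fun k hk => ?_) hi1 h
      have h1 := abs_lt.1 (hf (x k))
      have h2 : lam ≤ f (x k) := (Finset.mem_filter.1 hk).2
      linarith
    · intro h
      -- The margin `2 * η` is spent twice: `η` on moving from `z` to a nearby data point, `η` on
      -- passing from `f₀` to `f`. Data points near the component are therefore active for `f`.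
      have h' := (hstab lam (lam + 2 * η) (by linarith) (by linarith) (by linarith)
        _ hui _ huj).2 h
      refine reachable_of_connectedIn (activeSet f lam x) ht (hρ ⟨i, hi2⟩) (fun z hz k hk => ?_)
        (fun z hz => hcov z (by linarith)) hui h'
      have h1 := abs_lt.1 (hf (x k))
      have h2 := abs_lt.1 (hmodρ _ _ hk)
      exact Finset.mem_filter.2 ⟨Finset.mem_univ _, by linarith⟩

end Geometry

/-! ### The data-adaptive scale -/

section Adaptive

lemma quantile_mem_Icc {ι : Type*} {p r u : ℝ} (hp : 0 < p) (hp1 : p ≤ 1) {A : Finset ι}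
    (hA : A.Nonempty) {v : ι → ℝ} (hr : ∀ i ∈ A, r ≤ v i) (hu : ∀ i ∈ A, v i ≤ u) :
    quantile p A v ∈ Set.Icc r u := by
  have hc : (0 : ℝ) < A.card := by exact_mod_cast hA.card_pos
  have hmem : u ∈ {t : ℝ | p * (A.card : ℝ) ≤ ((A.filter (fun i => v i ≤ t)).card : ℝ)} := by
    rw [Set.mem_ofPred_eq, Finset.filter_true_of_mem hu]
    nlinarith
  have hlow : ∀ t ∈ {t : ℝ | p * (A.card : ℝ) ≤ ((A.filter (fun i => v i ≤ t)).card : ℝ)},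
      r ≤ t := by
    intro t ht
    by_contra! hlt
    rw [Set.mem_ofPred_eq, Finset.filter_false_of_mem
      (fun i hi => not_le.2 (hlt.trans_le (hr i hi)))] at ht
    simp only [Finset.card_empty, Nat.cast_zero] at ht
    nlinarith
  exact ⟨le_csInf ⟨u, hmem⟩ hlow, csInf_le ⟨r, hlow⟩ hmem⟩

variable {d n : ℕ} {x : Fin n → E d} {k : ℕ}

/-- The number of data points at distance less than `r` from `y`. -/
def ballCount (x : Fin n → E d) (y : E d) (r : ℝ) : ℕ :=
  ((Finset.univ : Finset (Fin n)).filter (fun j => x j ∈ Metric.ball y r)).card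

lemma ballCount_mono {y z : E d} {r s : ℝ} (h : Metric.ball y r ⊆ Metric.ball z s) :
    ballCount x y r ≤ ballCount x z s := by
  refine Finset.card_le_card fun j hj => ?_
  simp only [Finset.mem_filter, Finset.mem_univ, true_and] at hj ⊢
  exact h hj

lemma knnDist_mem_Icc {y : E d} {r u : ℝ} (hu : 0 < u) (hr : ballCount x y r < k)
    (hku : k ≤ ballCount x y u) : knnDist k x y ∈ Set.Icc r u := by
  have hmem : u ∈ {r : ℝ | 0 < r ∧
    k ≤ ((Finset.univ : Finset (Fin n)).filter (fun j => x j ∈ Metric.ball y r)).card} :=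
    ⟨hu, hku⟩
  refine ⟨le_csInf ⟨u, hmem⟩ fun s hs => ?_, csInf_le ⟨0, fun s hs => hs.1.le⟩ hmem⟩
  by_contra! hlt
  exact absurd (hs.2.trans (ballCount_mono (x := x) (Metric.ball_subset_ball hlt.le)))
    (not_le.2 hr)

/-- Points active for `fhat` satisfy `f₀ ≥ lam / 2`, so ball counts that are uniform over that level
set control every nearest neighbor distance entering the quantile. -/
lemma deltaHat_mem_Icc {γ lam r u : ℝ} {f₀ fhat : E d → ℝ} (hlam : 0 ≤ lam) (hγ : 0 ≤ γ)
    (hγ1 : γ < 1) (hu : 0 < u)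
    (hf : supDist fhat f₀ ≤ ENNReal.ofReal (lam / 2)) (hA : (activeSet fhat lam x).Nonempty)
    (hr : ∀ z, lam / 2 ≤ f₀ z → ballCount x z r < k)
    (hku : ∀ z, lam / 2 ≤ f₀ z → k ≤ ballCount x z u) :
    deltaHat k γ lam fhat x ∈ Set.Icc r u := by
  have key : ∀ i ∈ activeSet fhat lam x, knnDist k x (x i) ∈ Set.Icc r u := by
    intro i hi
    have h1 : lam ≤ fhat (x i) := (Finset.mem_filter.1 hi).2
    have h2 := abs_le.1 (abs_sub_le_of_supDist_le (by linarith) hf (x i))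
    exact knnDist_mem_Icc hu (hr _ (by linarith)) (hku _ (by linarith))
  exact quantile_mem_Icc (by linarith) (by linarith) hA (fun i hi => (key i hi).1)
    (fun i hi => (key i hi).2)

end Adaptive

/-! ### Counts of independent observations -/

section Counts

variable {Ω : Type*} [MeasurableSpace Ω] {P : Measure Ω} {d : ℕ}
  {X : ℕ → Ω → E d} {μ : Measure (E d)} [IsProbabilityMeasure μ] {B : Set (E d)}

lemma card_filter_sample {Ω : Type*} {d : ℕ} {X : ℕ → Ω → E d} {B : Set (E d)} (n : ℕ) (ω : Ω) :
    (((Finset.univ : Finset (Fin n)).filter (fun i => sample X n ω i ∈ B)).card : ℝ) =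
      ∑ i ∈ Finset.range n, B.indicator (fun _ => (1 : ℝ)) (X i ω) := by
  rw [Finset.sum_range, Finset.card_filter, Nat.cast_sum]
  refine Finset.sum_congr rfl fun i _ => ?_
  by_cases h : X i ω ∈ B <;> simp [sample, h]

lemma measure_forall_notMem_le (hX : ∀ i, HasLaw (X i) μ P) (hind : iIndepFun X P)
    (hB : MeasurableSet B) {p : ℝ} (hp : p ≤ μ.real B) (n : ℕ) :
    P {ω | ∀ i : Fin n, sample X n ω i ∉ B} ≤ ENNReal.ofReal (Real.exp (-(n * p))) := by
  have hset : {ω | ∀ i : Fin n, sample X n ω i ∉ B} =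
      ⋂ i ∈ Finset.range n, X i ⁻¹' Bᶜ := by
    ext ω
    simp only [sample, Set.mem_ofPred_eq, Set.mem_iInter, Finset.mem_range, Set.mem_preimage,
      Set.mem_compl_iff]
    exact ⟨fun h i hi => h ⟨i, hi⟩, fun h i => h i i.2⟩
  have hone : ∀ i, P (X i ⁻¹' Bᶜ) ≤ ENNReal.ofReal (Real.exp (-p)) := by
    intro i
    have h1 : P (X i ⁻¹' Bᶜ) = μ Bᶜ := (hX i).measure_eq (p := fun y => y ∈ Bᶜ) hB.compl
    rw [h1, ← ofReal_measureReal, probReal_compl_eq_one_sub hB]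
    exact ENNReal.ofReal_le_ofReal (by linarith [Real.add_one_le_exp (-p)])
  rw [hset, hind.measure_inter_preimage_eq_mul (Finset.range n) (sets := fun _ => Bᶜ)
    (fun _ _ => hB.compl)]
  refine (Finset.prod_le_prod' fun i _ => hone i).trans_eq ?_
  rw [Finset.prod_const, Finset.card_range, ← ENNReal.ofReal_pow (Real.exp_nonneg _),
    ← Real.exp_nat_mul]
  congr 2
  ring

/-- Chernoff bound with parameter 1: the indicator of `B` has exponential moment `1 + (exp 1 - 1) *
μ.real B`, at most `exp (2 * p)` because `exp 1 - 1 ≤ 2`. -/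
lemma measure_le_count_le [IsProbabilityMeasure P] (hX : ∀ i, HasLaw (X i) μ P) (hind : iIndepFun X P)
    (hB : MeasurableSet B) {p : ℝ} (hp : μ.real B ≤ p) (n k : ℕ) :
    P {ω | k ≤ ((Finset.univ : Finset (Fin n)).filter (fun i => sample X n ω i ∈ B)).card} ≤
      ENNReal.ofReal (Real.exp (-k + 2 * (n * p))) := by
  set g : E d → ℝ := B.indicator (fun _ => (1 : ℝ)) with hg
  have hgm : Measurable g := measurable_const.indicator hB
  set Y : ℕ → Ω → ℝ := fun i => g ∘ X i with hY
  have hYm : ∀ i, AEMeasurable (Y i) P := fun i => hgm.comp_aemeasurable (hX i).aemeasurable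
  have hYind : iIndepFun Y P := hind.comp (fun _ => g) (fun _ => hgm)
  have hexp : ∀ y, Real.exp (1 * g y) = 1 + (Real.exp 1 - 1) * g y := by
    intro y
    by_cases h : y ∈ B <;> simp [hg, h]
  have hgi : Integrable g μ := (integrable_const (1 : ℝ)).indicator hB
  have hmgf : ∀ i, mgf (Y i) P 1 ≤ Real.exp (2 * p) := by
    intro i
    have h1 : mgf (Y i) P 1 = ∫ y, Real.exp (1 * g y) ∂μ := by
      rw [← (hX i).map_eq, integral_map (hX i).aemeasurable (by fun_prop)]
      rfl
    have h2 : ∫ y, g y ∂μ = μ.real B := by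
      rw [hg, integral_indicator hB]; simp
    rw [h1]
    simp only [hexp]
    rw [integral_add (integrable_const _) (hgi.const_mul _), integral_const_mul, h2]
    simp only [integral_const, probReal_univ, smul_eq_mul, mul_one]
    have h3 := Real.exp_one_lt_d9
    have h4 := Real.add_one_le_exp (2 * p)
    have h5 : (0 : ℝ) ≤ μ.real B := measureReal_nonneg
    nlinarith
  have hset : {ω | k ≤ ((Finset.univ : Finset (Fin n)).filter
      (fun i => sample X n ω i ∈ B)).card} = {ω | (k : ℝ) ≤ (∑ i ∈ Finset.range n, Y i) ω} := by
    ext ω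
    simp only [Set.mem_ofPred_eq]
    rw [Finset.sum_apply, ← Nat.cast_le (α := ℝ), card_filter_sample]
    rfl
  have hint : Integrable (fun ω => Real.exp (1 * (∑ i ∈ Finset.range n, Y i) ω)) P := by
    refine Integrable.of_bound (C := Real.exp n) ?_ (Eventually.of_forall fun ω => ?_)
    · have : AEMeasurable (∑ i ∈ Finset.range n, Y i) P :=
        Finset.aemeasurable_sum _ fun i _ => hYm i
      exact (Real.measurable_exp.comp_aemeasurable (this.const_mul 1)).aestronglyMeasurable
    · rw [Real.norm_of_nonneg (Real.exp_nonneg _), one_mul, Finset.sum_apply]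
      refine Real.exp_le_exp.2 ((Finset.sum_le_card_nsmul _ _ 1 fun i _ => ?_).trans ?_)
      · exact Set.indicator_le_self' (fun _ _ => zero_le_one) _
      · simp
  have hfin := measure_ge_le_exp_mul_mgf (μ := P) (X := ∑ i ∈ Finset.range n, Y i) (t := 1)
    (k : ℝ) zero_le_one hint
  rw [hYind.mgf_sum₀ hYm] at hfin
  rw [hset, ← ofReal_measureReal]
  refine ENNReal.ofReal_le_ofReal (hfin.trans ?_)
  rw [Real.exp_add, neg_one_mul]
  refine mul_le_mul_of_nonneg_left ?_ (Real.exp_nonneg _)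
  refine (Finset.prod_le_prod (fun i _ => mgf_nonneg) fun i _ => hmgf i).trans_eq ?_
  rw [Finset.prod_const, Finset.card_range, ← Real.exp_nat_mul]
  congr 1
  ring

/-- The weak law of large numbers for counts. -/
lemma tendstoInMeasure_count [IsProbabilityMeasure P] (hX : ∀ i, HasLaw (X i) μ P) (hind : iIndepFun X P)
    (hB : MeasurableSet B) {κ : ℝ} (hκ : 0 < κ) :
    Tendsto (fun n : ℕ => P {ω | κ ≤ |(((Finset.univ : Finset (Fin n)).filter
      (fun i => sample X n ω i ∈ B)).card : ℝ) / n - μ.real B|}) atTop (𝓝 0) := by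
  set g : E d → ℝ := B.indicator (fun _ => (1 : ℝ)) with hg
  have hgm : Measurable g := measurable_const.indicator hB
  set Y : ℕ → Ω → ℝ := fun i => g ∘ X i with hY
  have hYm : ∀ i, AEMeasurable (Y i) P := fun i => hgm.comp_aemeasurable (hX i).aemeasurable
  have hYind : iIndepFun Y P := hind.comp (fun _ => g) (fun _ => hgm)
  have hgi : Integrable g μ := (integrable_const (1 : ℝ)).indicator hB
  have hmean : ∫ ω, Y 0 ω ∂P = μ.real B := by
    have h2 : ∫ y, g y ∂μ = μ.real B := by
      rw [hg, integral_indicator hB]; simp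
    rw [← h2, ← (hX 0).map_eq, integral_map (hX 0).aemeasurable hgm.aestronglyMeasurable]
    rfl
  have hid : ∀ i, IdentDistrib (Y i) (Y 0) P P := fun i =>
    (IdentDistrib.mk (hX i).aemeasurable (hX 0).aemeasurable
      ((hX i).map_eq.trans (hX 0).map_eq.symm)).comp hgm
  have hYi : Integrable (Y 0) P := by
    have := hgi
    rw [← (hX 0).map_eq] at this
    exact this.comp_aemeasurable (hX 0).aemeasurable
  have hlln := strong_law_ae_real Y hYi (fun i j hij => hYind.indepFun hij) hid
  rw [hmean] at hlln
  have hmeas := tendstoInMeasure_of_tendsto_ae (μ := P)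
    (f := fun (n : ℕ) ω => (∑ i ∈ Finset.range n, Y i ω) / (n : ℝ)) (g := fun _ => μ.real B)
    (fun n => ((Finset.aemeasurable_fun_sum _ fun i _ => hYm i).div_const _).aestronglyMeasurable)
    hlln
  rw [tendstoInMeasure_iff_norm] at hmeas
  simp only [card_filter_sample]
  exact hmeas κ hκ

/-- A maximal `r`-separated subset of `S` is an `r`-net. Its half-radius balls are disjoint with
mass at least `c` each, so there are at most `c⁻¹` of them. Counting with the probability `μ` itself
avoids any boundedness of `S`. -/
lemma exists_net {S : Set (E d)} {r c : ℝ} (hc : 0 < c)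
    (hS : ∀ z ∈ S, c ≤ μ.real (Metric.ball z (r / 2))) :
    ∃ N : Finset (E d), (∀ w ∈ N, w ∈ S) ∧ (∀ z ∈ S, ∃ w ∈ N, dist z w < r) ∧
      (N.card : ℝ) ≤ c⁻¹ := by
  let Q : ℕ → Prop := fun k => ∃ N : Finset (E d), N.card = k ∧ (∀ w ∈ N, w ∈ S) ∧
    ∀ w ∈ N, ∀ w' ∈ N, w ≠ w' → r ≤ dist w w'
  have hcard : ∀ N : Finset (E d), (∀ w ∈ N, w ∈ S) →
      (∀ w ∈ N, ∀ w' ∈ N, w ≠ w' → r ≤ dist w w') → (N.card : ℝ) ≤ c⁻¹ := by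
    intro N hN hsep
    have h1 : μ.real (⋃ w ∈ N, Metric.ball w (r / 2)) = ∑ w ∈ N, μ.real (Metric.ball w (r / 2)) := by
      refine measureReal_biUnion_finset ?_ (fun _ _ => Metric.isOpen_ball.measurableSet)
      intro w hw w' hw' hne
      exact Metric.ball_disjoint_ball (by linarith [hsep w hw w' hw' hne])
    have h2 : (N.card : ℝ) * c ≤ ∑ w ∈ N, μ.real (Metric.ball w (r / 2)) := by
      rw [← nsmul_eq_mul]
      exact Finset.card_nsmul_le_sum _ _ _ fun w hw => hS w (hN w hw)
    have h3 : μ.real (⋃ w ∈ N, Metric.ball w (r / 2)) ≤ 1 := measureReal_le_one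
    rw [← one_div, le_div_iff₀ hc]
    linarith
  have h0 : Q 0 := ⟨∅, by simp⟩
  obtain ⟨N, hNc, hNS, hsep⟩ := Nat.findGreatest_spec (P := Q) (Nat.zero_le ⌊c⁻¹⌋₊) h0
  refine ⟨N, hNS, fun z hz => ?_, hcard N hNS hsep⟩
  by_contra! hfar
  have hr : 0 < r := by
    by_contra! hr
    have := hS z hz
    rw [Metric.ball_eq_empty.2 (by linarith), measureReal_empty] at this
    linarith
  have hzN : z ∉ N := fun h => by have := hfar z h; rw [dist_self] at this; linarith
  have hNS' : ∀ w ∈ insert z N, w ∈ S := by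
    intro w hw
    rcases Finset.mem_insert.1 hw with rfl | hw
    exacts [hz, hNS w hw]
  have hsep' : ∀ w ∈ insert z N, ∀ w' ∈ insert z N, w ≠ w' → r ≤ dist w w' := by
    intro w hw w' hw' hne
    rcases Finset.mem_insert.1 hw with h | hw <;> rcases Finset.mem_insert.1 hw' with h' | hw'
    · exact absurd (h.trans h'.symm) hne
    · rw [h]; exact hfar w' hw'
    · rw [h', dist_comm]; exact hfar w hw
    · exact hsep w hw w' hw' hne
  have hQ : Q (N.card + 1) := ⟨insert z N, Finset.card_insert_of_notMem hzN, hNS', hsep'⟩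
  have hle : N.card + 1 ≤ ⌊c⁻¹⌋₊ := by
    refine Nat.le_floor ?_
    have := hcard _ hNS' hsep'
    rwa [Finset.card_insert_of_notMem hzN] at this
  have := Nat.le_findGreatest hle hQ
  omega

/-- Union bound over a net. -/
lemma measure_exists_le_of_net {S : Set (E d)} {r c : ℝ} (hc : 0 < c)
    (hS : ∀ z ∈ S, c ≤ μ.real (Metric.ball z (r / 2))) {bad : E d → Set Ω} {bad' : E d → Set Ω}
    (hbad : ∀ z ∈ S, ∀ w ∈ S, dist z w < r → bad z ⊆ bad' w) {q : ℝ} (hq : 0 ≤ q)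
    (hbad' : ∀ w ∈ S, P (bad' w) ≤ ENNReal.ofReal q) :
    P {ω | ∃ z ∈ S, ω ∈ bad z} ≤ ENNReal.ofReal (c⁻¹ * q) := by
  obtain ⟨N, hNS, hN, hcard⟩ := exists_net (μ := μ) hc hS
  calc P {ω | ∃ z ∈ S, ω ∈ bad z} ≤ P (⋃ w ∈ N, bad' w) := by
        refine measure_mono ?_
        rintro ω ⟨z, hz, hω⟩
        obtain ⟨w, hw, hzw⟩ := hN z hz
        exact Set.mem_biUnion hw (hbad z hz w (hNS w hw) hzw hω)
    _ ≤ ∑ w ∈ N, P (bad' w) := measure_biUnion_finset_le _ _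
    _ ≤ N.card • ENNReal.ofReal q := Finset.sum_le_card_nsmul _ _ _ fun w hw => hbad' w (hNS w hw)
    _ = ENNReal.ofReal (N.card * q) := by
        rw [nsmul_eq_mul, ENNReal.ofReal_mul (Nat.cast_nonneg _), ENNReal.ofReal_natCast]
    _ ≤ _ := ENNReal.ofReal_le_ofReal (mul_le_mul_of_nonneg_right hcard hq)

/-- The probability that some ball around a point of `S` contains no data. -/
lemma measure_uncovered_le (hX : ∀ i, HasLaw (X i) μ P) (hind : iIndepFun X P)
    {S : Set (E d)} {r s c p : ℝ} (hc : 0 < c)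
    (hS : ∀ z ∈ S, c ≤ μ.real (Metric.ball z (s / 2)))
    (hp : ∀ z ∈ S, p ≤ μ.real (Metric.ball z r)) (n : ℕ) :
    P {ω | ∃ z ∈ S, ∀ i, ¬ dist (sample X n ω i) z < r + s} ≤
      ENNReal.ofReal (c⁻¹ * Real.exp (-(n * p))) := by
  refine measure_exists_le_of_net (μ := μ) hc hS
    (bad := fun z => {ω | ∀ i, ¬ dist (sample X n ω i) z < r + s})
    (bad' := fun w => {ω | ∀ i, sample X n ω i ∉ Metric.ball w r}) ?_ (Real.exp_nonneg _)
    (fun w hw => measure_forall_notMem_le hX hind Metric.isOpen_ball.measurableSet (hp w hw) n)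
  intro z _ w _ hzw ω hω i hi
  refine hω i ?_
  have := dist_triangle (sample X n ω i) w z
  rw [dist_comm w z] at this
  rw [Metric.mem_ball] at hi
  linarith

/-- The probability that some ball around a point of `S` contains many data points. -/
lemma measure_crowded_le [IsProbabilityMeasure P] (hX : ∀ i, HasLaw (X i) μ P) (hind : iIndepFun X P)
    {S : Set (E d)} {r c p : ℝ} (hc : 0 < c)
    (hS : ∀ z ∈ S, c ≤ μ.real (Metric.ball z (r / 2)))
    (hp : ∀ z ∈ S, μ.real (Metric.ball z (2 * r)) ≤ p) (n k : ℕ) :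
    P {ω | ∃ z ∈ S, ¬ ballCount (sample X n ω) z r < k} ≤
      ENNReal.ofReal (c⁻¹ * Real.exp (-k + 2 * (n * p))) := by
  refine measure_exists_le_of_net (μ := μ) hc hS
    (bad := fun z => {ω | ¬ ballCount (sample X n ω) z r < k})
    (bad' := fun w => {ω | k ≤ ((Finset.univ : Finset (Fin n)).filter
      (fun i => sample X n ω i ∈ Metric.ball w (2 * r))).card}) ?_ (Real.exp_nonneg _)
    (fun w hw => measure_le_count_le hX hind Metric.isOpen_ball.measurableSet (hp w hw) n k)
  intro z _ w _ hzw ω hω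
  have hω' : k ≤ ballCount (sample X n ω) z r := not_lt.1 hω
  exact hω'.trans (ballCount_mono (Metric.ball_subset_ball' (by linarith)))

/-- Balls of a fixed radius eventually contain more than `k n ≪ n` data points. -/
lemma tendsto_measure_sparse [IsProbabilityMeasure P] (hX : ∀ i, HasLaw (X i) μ P) (hind : iIndepFun X P)
    {S : Set (E d)} {r c : ℝ} (hc : 0 < c)
    (hS : ∀ z ∈ S, c ≤ μ.real (Metric.ball z (r / 2))) {k : ℕ → ℕ}
    (hk : (fun n : ℕ => (k n : ℝ)) =o[atTop] (fun n : ℕ => (n : ℝ))) :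
    Tendsto (fun n => P {ω | ∃ z ∈ S, ¬ k n ≤ ballCount (sample X n ω) z (2 * r)})
      atTop (𝓝 0) := by
  obtain ⟨N, hNS, hN, -⟩ := exists_net (μ := μ) hc hS
  have hlim : Tendsto (fun n : ℕ => ∑ w ∈ N, P {ω | c / 2 ≤ |(((Finset.univ :
      Finset (Fin n)).filter (fun i => sample X n ω i ∈ Metric.ball w r)).card : ℝ) / n -
      μ.real (Metric.ball w r)|}) atTop (𝓝 0) := by
    rw [show (0 : ℝ≥0∞) = ∑ w ∈ N, 0 by simp]
    exact tendsto_finsetSum _ fun w _ =>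
      tendstoInMeasure_count hX hind Metric.isOpen_ball.measurableSet (half_pos hc)
  refine tendsto_of_tendsto_of_tendsto_of_le_of_le' tendsto_const_nhds hlim
    (Eventually.of_forall fun _ => zero_le) ?_
  -- A sparse ball at `z` makes the ball at a net point `w` hold at most a fraction `c / 4` of the
  -- data, although its mass is at least `c`: a deviation of more than `c / 2`. The net does not
  -- depend on `n`, so finitely many laws of large numbers suffice.
  filter_upwards [hk.bound (c := c / 4) (by positivity), eventually_gt_atTop 0] with n hn hn0
  refine (measure_mono ?_).trans (measure_biUnion_finset_le N _)
  rintro ω ⟨z, hz, hω⟩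
  obtain ⟨w, hw, hzw⟩ := hN z hz
  refine Set.mem_biUnion hw ?_
  have h1 : ballCount (sample X n ω) w r ≤ ballCount (sample X n ω) z (2 * r) :=
    ballCount_mono (Metric.ball_subset_ball' (by rw [dist_comm w z]; linarith))
  have h2 : (ballCount (sample X n ω) w r : ℝ) ≤ k n := by
    exact_mod_cast h1.trans (not_le.1 hω).le
  have hn' : (0 : ℝ) < n := by exact_mod_cast hn0
  rw [Real.norm_of_nonneg (Nat.cast_nonneg _), Real.norm_of_nonneg hn'.le] at hn
  have hr : 0 ≤ r := dist_nonneg.trans hzw.le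
  have h3 : c ≤ μ.real (Metric.ball w r) :=
    (hS w (hNS w hw)).trans (measureReal_mono (Metric.ball_subset_ball (by linarith)))
  have h4 : (ballCount (sample X n ω) w r : ℝ) / n ≤ c / 4 := by
    rw [div_le_iff₀ hn']; linarith
  have h5 : c / 2 ≤ |(ballCount (sample X n ω) w r : ℝ) / n - μ.real (Metric.ball w r)| := by
    rw [abs_sub_comm]
    exact le_trans (by linarith) (le_abs_self _)
  exact h5

end Counts

/-! ### Masses of balls and strips -/

section Law

variable {d : ℕ}

/-- The volume of the unit ball. -/
def unitVol (d : ℕ) : ℝ := (volume (Metric.ball (0 : E d) 1)).toReal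

lemma unitVol_pos : 0 < unitVol d :=
  ENNReal.toReal_pos (Metric.measure_ball_pos _ _ one_pos).ne' measure_ball_lt_top.ne

lemma volume_ball_eq (z : E d) {r : ℝ} (hr : 0 < r) :
    volume (Metric.ball z r) = ENNReal.ofReal (r ^ d * unitVol d) := by
  rw [Measure.addHaar_ball_of_pos volume z hr, finrank_euclideanSpace_fin,
    ENNReal.ofReal_mul (by positivity), unitVol, ENNReal.ofReal_toReal measure_ball_lt_top.ne]

instance (f : Density d) : IsProbabilityMeasure f.law :=
  ⟨by rw [Density.law, withDensity_apply _ MeasurableSet.univ, setLIntegral_univ,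
    f.lintegral_eq_one']⟩

lemma le_law_ball (f : Density d) {z : E d} {r l : ℝ} (hr : 0 < r) (hl : 0 ≤ l)
    (h : ∀ y ∈ Metric.ball z r, l ≤ f y) :
    l * (r ^ d * unitVol d) ≤ f.law.real (Metric.ball z r) := by
  have hv := unitVol_pos (d := d)
  rw [measureReal_def, ← ENNReal.ofReal_le_iff_le_toReal (measure_ne_top _ _), Density.law,
    withDensity_apply _ Metric.isOpen_ball.measurableSet, ENNReal.ofReal_mul hl,
    ← volume_ball_eq z hr, ← setLIntegral_const]
  exact setLIntegral_mono' Metric.isOpen_ball.measurableSet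
    fun y hy => ENNReal.ofReal_le_ofReal (h y hy)

lemma law_ball_le (f : Density d) (z : E d) {r M : ℝ} (hr : 0 < r) (hM : 0 ≤ M)
    (h : ∀ y, f y ≤ M) :
    f.law.real (Metric.ball z r) ≤ M * (r ^ d * unitVol d) := by
  have hv := unitVol_pos (d := d)
  refine ENNReal.toReal_le_of_le_ofReal (by positivity) ?_
  rw [Density.law,
    withDensity_apply _ Metric.isOpen_ball.measurableSet, ENNReal.ofReal_mul hM,
    ← volume_ball_eq z hr, ← setLIntegral_const]
  exact setLIntegral_mono' Metric.isOpen_ball.measurableSet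
    fun y _ => ENNReal.ofReal_le_ofReal (h y)

lemma measurableSet_strip (f : Density d) (lam ε : ℝ) :
    MeasurableSet {x | |f x - lam| ≤ ε} := by
  have := f.measurable'
  exact measurableSet_le (by fun_prop) measurable_const

lemma law_strip_le (f : Density d) {lam C εbar ε : ℝ} (h : FastMassDecay f lam C εbar)
    (hε : 0 < ε) (hε' : ε < εbar) : f.law.real {x | |f x - lam| ≤ ε} ≤ C * ε := by
  refine le_trans (le_of_eq ?_) (h ε hε hε')
  rw [measureReal_def, Density.law, withDensity_apply _ (measurableSet_strip f lam ε),
    integral_eq_lintegral_of_nonneg_ae (Eventually.of_forall f.nonneg')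
      f.measurable'.aestronglyMeasurable]

lemma exists_bound (f : Density d) (hcont : Continuous f)
    (hvanish : Tendsto f (cocompact (E d)) (𝓝 0)) : ∃ M, 0 ≤ M ∧ ∀ y, f y ≤ M := by
  let g : ZeroAtInftyContinuousMap (E d) ℝ := ⟨⟨f, hcont⟩, hvanish⟩
  exact ⟨‖g.toBCF‖, norm_nonneg _, fun y =>
    (le_abs_self _).trans (g.toBCF.norm_coe_le_norm y)⟩

end Law

/-! ### The lower bound for the scale -/

section Scale

variable {d n : ℕ} {lam : ℝ}

/-- The normalization behind `rLower`: a ball of radius `r_n / 2` on which the density equals `lam`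
expects `16 d log n` data points. -/
lemma half_rLower_pow (hd : 1 ≤ d) (hlam : 0 < lam) (hn : 1 ≤ n) :
    (n : ℝ) * (lam * ((rLower n d lam / 2) ^ d * unitVol d)) = 16 * d * Real.log n := by
  have hv := unitVol_pos (d := d)
  have hn' : (0 : ℝ) < n := by exact_mod_cast hn
  have hlog : 0 ≤ Real.log n := Real.log_natCast_nonneg n
  have hb : 0 ≤ 16 * d * Real.log n / (n * lam * unitVol d) := by positivity
  have hpow : (rLower n d lam / 2) ^ d = 16 * d * Real.log n / (n * lam * unitVol d) := by
    rw [rLower, mul_div_cancel_left₀ _ (two_ne_zero), one_div,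
      Real.rpow_inv_natCast_pow (by exact hb) (by omega)]
    rfl
  rw [hpow]
  field_simp

lemma rLower_pos (hd : 1 ≤ d) (hlam : 0 < lam) (hn : 2 ≤ n) : 0 < rLower n d lam := by
  have hv : 0 < (volume (Metric.ball (0 : E d) 1)).toReal := unitVol_pos
  have hlog : 0 < Real.log n := Real.log_pos (by exact_mod_cast hn)
  have hn' : (0 : ℝ) < n := by positivity
  have hd' : (0 : ℝ) < d := by exact_mod_cast hd
  unfold rLower
  positivity

lemma tendsto_rLower (hd : 1 ≤ d) :
    Tendsto (fun n : ℕ => rLower n d lam) atTop (𝓝 0) := by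
  have h1 : Tendsto (fun n : ℕ => Real.log n / (n : ℝ)) atTop (𝓝 0) :=
    (Real.isLittleO_log_id_atTop.tendsto_div_nhds_zero).comp tendsto_natCast_atTop_atTop
  have h2 : Tendsto (fun n : ℕ => 16 * d * Real.log n / (n * lam * unitVol d)) atTop (𝓝 0) := by
    have h3 := h1.const_mul (16 * d / (lam * unitVol d))
    rw [mul_zero] at h3
    refine h3.congr fun n => ?_
    rw [div_mul_div_comm]
    congr 1
    ring
  have hd' : (0 : ℝ) < d := by exact_mod_cast hd
  have h4 := (h2.rpow_const (p := 1 / (d : ℝ)) (Or.inr (by positivity))).const_mul 2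
  rw [Real.zero_rpow (by positivity), mul_zero] at h4
  exact h4

lemma inv_mass_le (hd : 1 ≤ d) (hn : 2 ≤ n) {q : ℝ} (hq : (n : ℝ) * q = 16 * d * Real.log n) :
    0 < q ∧ q⁻¹ ≤ n := by
  have hn' : (2 : ℝ) ≤ n := by exact_mod_cast hn
  have hd' : (1 : ℝ) ≤ d := by exact_mod_cast hd
  have hlog : (1 / 2 : ℝ) ≤ Real.log n := by
    have h1 := Real.log_two_gt_d9
    have h2 := Real.log_le_log two_pos hn'
    linarith
  have h1 : 1 ≤ (n : ℝ) * q := by rw [hq]; nlinarith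
  have hq0 : 0 < q := by
    by_contra! h
    nlinarith
  refine ⟨hq0, ?_⟩
  rw [inv_le_iff_one_le_mul₀ hq0]
  exact h1

end Scale

/-! ### Events of high probability -/

section Events

variable {Ω : Type*} [MeasurableSpace Ω] {P : Measure Ω} {d : ℕ} {X : ℕ → Ω → E d}
  {f₀ : Density d} {lam : ℝ}

lemma tendsto_ofReal_const_mul_exp_neg_log (K : ℝ) :
    Tendsto (fun n : ℕ => ENNReal.ofReal (K * Real.exp (-Real.log n))) atTop (𝓝 0) := by
  have h := ((Real.tendsto_exp_neg_atTop_nhds_zero.comp Real.tendsto_log_atTop).comp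
    (tendsto_natCast_atTop_atTop (R := ℝ))).const_mul K
  rw [mul_zero] at h
  simpa using ENNReal.tendsto_ofReal h

lemma exists_modulus (hcont : Continuous f₀) (hvanish : Tendsto f₀ (cocompact (E d)) (𝓝 0))
    {κ : ℝ} (hκ : 0 < κ) : ∃ ρ : ℝ, 0 < ρ ∧ ∀ y z, dist y z < ρ → |f₀ y - f₀ z| < κ := by
  obtain ⟨ρ, hρ, h⟩ := Metric.uniformContinuous_iff.1
    (hcont.uniformContinuous_of_tendsto_cocompact hvanish) κ hκ
  exact ⟨ρ, hρ, fun y z hyz => by rw [← Real.dist_eq]; exact h hyz⟩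

/-- Within distance `ρ` of a point where `f₀ ≥ lam / 2`, the density still exceeds `lam / 4`. -/
lemma le_law_ball_of_levelSet (hlam : 0 < lam) {ρ : ℝ}
    (hmod : ∀ y z, dist y z < ρ → |f₀ y - f₀ z| < lam / 4) {r : ℝ} (hr : 0 < r) (hrρ : r ≤ ρ)
    {z : E d} (hz : z ∈ levelSet f₀ (lam / 2)) :
    lam / 4 * (r ^ d * unitVol d) ≤ f₀.law.real (Metric.ball z r) := by
  refine le_law_ball f₀ hr (by positivity) fun y hy => ?_
  have h1 := abs_lt.1 (hmod y z (lt_of_lt_of_le hy hrρ))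
  have h2 : lam / 2 ≤ f₀ z := hz
  linarith

/-- With `r = r_n / 2`, take a net of spacing `τ r / 2` and balls of radius `(1 - τ) r` around its
points. Each ball has mass at least `q / 8`, hence is empty with probability at most `exp (-2 d log
n) ≤ n⁻²`, while the net has `O(n)` points; the union bound is `O(1 / n)`. -/
lemma tendsto_measure_uncovered (hd : 1 ≤ d) (hlam : 0 < lam) (hcont : Continuous f₀)
    (hvanish : Tendsto f₀ (cocompact (E d)) (𝓝 0))
    (hX : ∀ i, HasLaw (X i) f₀.law P) (hind : iIndepFun X P) {τ : ℝ} (hτ : 0 < τ)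
    (hτ1 : τ < 1) (hτd : 1 / 2 ≤ (1 - τ) ^ d) :
    Tendsto (fun n => P {ω | ∃ z ∈ levelSet f₀ lam, ∀ i, ¬ dist (sample X n ω i) z <
      (1 - τ) * (rLower n d lam / 2) + τ / 2 * (rLower n d lam / 2)}) atTop (𝓝 0) := by
  obtain ⟨ρ, hρ, hmod⟩ := exists_modulus hcont hvanish (κ := lam / 4) (by positivity)
  refine tendsto_of_tendsto_of_tendsto_of_le_of_le' tendsto_const_nhds
    (tendsto_ofReal_const_mul_exp_neg_log (4 * ((τ / 4) ^ d)⁻¹))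
    (Eventually.of_forall fun _ => zero_le) ?_
  filter_upwards [eventually_ge_atTop 2, (tendsto_rLower (lam := lam) hd).eventually_lt_const hρ]
    with n hn hrρ
  have hr := rLower_pos hd hlam hn
  have hv := unitVol_pos (d := d)
  have hpow := half_rLower_pow hd hlam (one_le_two.trans hn)
  set r := rLower n d lam / 2 with hrdef
  have hr0 : 0 < r := by positivity
  have hn' : (0 : ℝ) < n := by positivity
  have hlog : 0 ≤ Real.log n := Real.log_natCast_nonneg n
  have hd' : (1 : ℝ) ≤ d := by exact_mod_cast hd
  obtain ⟨hq, hqn⟩ := inv_mass_le hd hn hpow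
  set q := lam * (r ^ d * unitVol d) with hqdef
  have hsub : ∀ z ∈ levelSet f₀ lam, z ∈ levelSet f₀ (lam / 2) := fun z hz =>
    le_trans (by linarith : lam / 2 ≤ lam) hz
  have hc : 0 < (τ / 4) ^ d * q / 4 := by positivity
  refine (measure_uncovered_le hX hind (S := levelSet f₀ lam) hc (p := q / 8)
    (fun z hz => ?_) (fun z hz => ?_) n).trans (ENNReal.ofReal_le_ofReal ?_)
  · refine le_trans (le_of_eq ?_) (le_law_ball_of_levelSet hlam hmod (by positivity) (by nlinarith)
      (hsub z hz))
    rw [hqdef, show τ / 2 * r / 2 = τ / 4 * r by ring, mul_pow (τ / 4) r]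
    ring
  · refine le_trans ?_ (le_law_ball_of_levelSet hlam hmod (r := (1 - τ) * r)
      (mul_pos (by linarith) hr0) (by nlinarith) (hsub z hz))
    rw [mul_pow]
    have : lam / 4 * ((1 - τ) ^ d * r ^ d * unitVol d) = (1 - τ) ^ d * q / 4 := by
      rw [hqdef]; ring
    rw [this]
    nlinarith
  · have h1 : ((τ / 4) ^ d * q / 4)⁻¹ = 4 * ((τ / 4) ^ d)⁻¹ * q⁻¹ := by
      field_simp
    have h2 : Real.exp (-(n * (q / 8))) ≤ Real.exp (-Real.log n) * Real.exp (-Real.log n) := by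
      rw [← Real.exp_add]
      refine Real.exp_le_exp.2 ?_
      have : (n : ℝ) * (q / 8) = 2 * d * Real.log n := by
        rw [← mul_div_assoc, hpow]; ring
      rw [this]
      nlinarith
    have h3 : (n : ℝ) * Real.exp (-Real.log n) = 1 := by
      rw [Real.exp_neg, Real.exp_log hn', mul_inv_cancel₀ hn'.ne']
    rw [h1]
    have h4 : q⁻¹ * Real.exp (-(n * (q / 8))) ≤ Real.exp (-Real.log n) := by
      calc q⁻¹ * Real.exp (-(n * (q / 8)))
          ≤ n * (Real.exp (-Real.log n) * Real.exp (-Real.log n)) := by gcongr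
        _ = Real.exp (-Real.log n) := by rw [← mul_assoc, h3, one_mul]
    rw [mul_assoc]
    exact mul_le_mul_of_nonneg_left h4 (by positivity)

/-- Since `f₀` is bounded, a ball of radius `2 * r_n` expects only `O(log n)` points, far fewer than
`k n`. Chernoff beats the `O(n)` size of the net. -/
lemma tendsto_measure_crowded [IsProbabilityMeasure P] (hd : 1 ≤ d) (hlam : 0 < lam)
    (hcont : Continuous f₀) (hvanish : Tendsto f₀ (cocompact (E d)) (𝓝 0))
    (hX : ∀ i, HasLaw (X i) f₀.law P) (hind : iIndepFun X P) {k : ℕ → ℕ}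
    (hk : (fun n : ℕ => Real.log n) =o[atTop] (fun n : ℕ => (k n : ℝ))) :
    Tendsto (fun n => P {ω | ∃ z ∈ levelSet f₀ (lam / 2),
      ¬ ballCount (sample X n ω) z (rLower n d lam) < k n}) atTop (𝓝 0) := by
  obtain ⟨ρ, hρ, hmod⟩ := exists_modulus hcont hvanish (κ := lam / 4) (by positivity)
  obtain ⟨M, hM0, hM⟩ := exists_bound f₀ hcont hvanish
  set c' : ℝ := 2 * (M / lam * 4 ^ d * (16 * d)) with hc'
  have hc'0 : 0 ≤ c' := by positivity
  refine tendsto_of_tendsto_of_tendsto_of_le_of_le' tendsto_const_nhds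
    (tendsto_ofReal_const_mul_exp_neg_log 4) (Eventually.of_forall fun _ => zero_le) ?_
  -- The constant gives `(c' + 2) * log n ≤ k n`, so the Chernoff exponent `-k n + c' * log n` is at
  -- most `-2 * log n`.
  filter_upwards [eventually_ge_atTop 2, (tendsto_rLower (lam := lam) hd).eventually_lt_const hρ,
    hk.bound (c := (c' + 2)⁻¹) (by positivity)] with n hn hrρ hkn
  have hr := rLower_pos hd hlam hn
  have hv := unitVol_pos (d := d)
  have hpow := half_rLower_pow hd hlam (one_le_two.trans hn)
  have hn' : (0 : ℝ) < n := by positivity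
  have hlog : 0 ≤ Real.log n := Real.log_natCast_nonneg n
  obtain ⟨hq, hqn⟩ := inv_mass_le hd hn hpow
  set r := rLower n d lam with hrdef
  set q := lam * ((r / 2) ^ d * unitVol d) with hqdef
  have hc : 0 < q / 4 := by positivity
  refine (measure_crowded_le hX hind (S := levelSet f₀ (lam / 2)) hc
    (p := M / lam * 4 ^ d * q) (fun z hz => ?_) (fun z _ => ?_) n (k n)).trans
    (ENNReal.ofReal_le_ofReal ?_)
  · refine le_trans (le_of_eq ?_) (le_law_ball_of_levelSet hlam hmod (by positivity) (by linarith)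
      hz)
    rw [hqdef]; ring
  · refine (law_ball_le f₀ z (by positivity) hM0 hM).trans (le_of_eq ?_)
    rw [hqdef, show 2 * r = 4 * (r / 2) by ring, mul_pow 4 (r / 2)]
    field_simp
  · rw [Real.norm_of_nonneg hlog, Real.norm_of_nonneg (Nat.cast_nonneg _), inv_mul_eq_div,
      le_div_iff₀ (by positivity)] at hkn
    have h1 : 2 * (n * (M / lam * 4 ^ d * q)) = c' * Real.log n := by
      rw [hc']
      calc 2 * (n * (M / lam * 4 ^ d * q)) = 2 * (M / lam * 4 ^ d) * (n * q) := by ring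
        _ = _ := by rw [hpow]; ring
    have h2 : Real.exp (-(k n : ℝ) + 2 * (n * (M / lam * 4 ^ d * q))) ≤
        Real.exp (-Real.log n) * Real.exp (-Real.log n) := by
      rw [← Real.exp_add, h1]
      exact Real.exp_le_exp.2 (by linarith)
    have h3 : (n : ℝ) * Real.exp (-Real.log n) = 1 := by
      rw [Real.exp_neg, Real.exp_log hn', mul_inv_cancel₀ hn'.ne']
    calc (q / 4)⁻¹ * Real.exp (-(k n : ℝ) + 2 * (n * (M / lam * 4 ^ d * q)))
        ≤ (4 * n) * (Real.exp (-Real.log n) * Real.exp (-Real.log n)) := by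
          rw [inv_div, div_eq_mul_inv]; gcongr
      _ = 4 * ((n * Real.exp (-Real.log n)) * Real.exp (-Real.log n)) := by ring
      _ = 4 * Real.exp (-Real.log n) := by rw [h3, one_mul]

lemma exists_tendsto_measure_sparse [IsProbabilityMeasure P] (hlam : 0 < lam)
    (hcont : Continuous f₀) (hvanish : Tendsto f₀ (cocompact (E d)) (𝓝 0))
    (hX : ∀ i, HasLaw (X i) f₀.law P) (hind : iIndepFun X P) {k : ℕ → ℕ}
    (hk : (fun n : ℕ => (k n : ℝ)) =o[atTop] (fun n : ℕ => (n : ℝ))) {δbar : ℝ} (hδ : 0 < δbar) :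
    ∃ u, 0 < u ∧ u ≤ δbar ∧ Tendsto (fun n => P {ω | ∃ z ∈ levelSet f₀ (lam / 2),
      ¬ k n ≤ ballCount (sample X n ω) z u}) atTop (𝓝 0) := by
  obtain ⟨ρ, hρ, hmod⟩ := exists_modulus hcont hvanish (κ := lam / 4) (by positivity)
  have hv := unitVol_pos (d := d)
  set r := min ρ (δbar / 2) with hr
  have hr0 : 0 < r := lt_min hρ (by positivity)
  have h1 : r ≤ ρ := min_le_left _ _
  have h2 : r ≤ δbar / 2 := min_le_right _ _
  refine ⟨2 * r, by positivity, by linarith, ?_⟩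
  exact tendsto_measure_sparse hX hind (c := lam / 4 * ((r / 2) ^ d * unitVol d)) (by positivity)
    (fun z hz => le_law_ball_of_levelSet hlam hmod (by positivity) (by linarith) hz) hk

/-- The event that the scale is not admissible has vanishing probability. -/
lemma tendsto_measure_bad_scale [IsProbabilityMeasure P] (hd : 1 ≤ d) (hlam : 0 < lam)
    (hcont : Continuous f₀) (hvanish : Tendsto f₀ (cocompact (E d)) (𝓝 0))
    (hX : ∀ i, HasLaw (X i) f₀.law P) (hind : iIndepFun X P) {δbar : ℝ} (hδ : 0 < δbar)
    {δ : (n : ℕ) → (Fin n → E d) → ℝ}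
    (h : DeterministicScale lam δbar δ ∨ AdaptiveScale P X f₀ lam δ) :
    Tendsto (fun n => P {ω | ¬ (δ n (sample X n ω) ≤ δbar ∧
      ((activeSet f₀ lam (sample X n ω)).Nonempty → rLower n d lam ≤ δ n (sample X n ω)))})
      atTop (𝓝 0) := by
  rcases h with ⟨s, hs, hev⟩ | ⟨γ, k, fhat, hγ, hγ1, hk1, hk2, hgood, hδe⟩
  · refine tendsto_const_nhds.congr' ?_
    filter_upwards [hev] with n hn
    simp only [hs]
    simp [hn.1, hn.2.le]
  · obtain ⟨u, hu, hub, hsparse⟩ :=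
      exists_tendsto_measure_sparse hlam hcont hvanish hX hind hk2 hδ
    have hlim := (hgood.add (tendsto_measure_crowded hd hlam hcont hvanish hX hind hk1)).add hsparse
    rw [add_zero, add_zero] at hlim
    refine tendsto_of_tendsto_of_tendsto_of_le_of_le tendsto_const_nhds hlim
      (fun _ => zero_le) fun n => ?_
    refine le_trans (measure_mono ?_) ((measure_union_le _ _).trans
      (add_le_add_left (measure_union_le _ _) _))
    intro ω hω
    by_contra hnot
    rw [Set.mem_union, Set.mem_union, not_or, not_or] at hnot
    obtain ⟨⟨h12, h3⟩, h4⟩ := hnot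
    obtain ⟨h1, h2⟩ := not_not.1 h12
    simp only [Set.mem_ofPred_eq, not_exists, not_and, not_not] at h3 h4
    refine hω ?_
    rw [hδe]
    by_cases hA : (activeSet (fhat n (sample X n ω)) lam (sample X n ω)).Nonempty
    · have := deltaHat_mem_Icc hlam.le hγ hγ1 hu h1 hA h3 h4
      exact ⟨this.2.trans hub, fun _ => this.1⟩
    · refine ⟨?_, fun hne => absurd (h2 hne) hA⟩
      rw [Finset.not_nonempty_iff_eq_empty] at hA
      -- For an empty family every `t` qualifies, and the infimum of all of `ℝ` is 0 by convention,
      -- so the scale is below `δbar`.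
      simp only [deltaHat, quantile, hA]
      simp [hδ.le]

end Events

/-! ### The estimate -/

section Estimate

variable {d n : ℕ} [MeasurableSpace (Density d)]

/-- The loss depends on `f` only through its active set, which takes finitely many values and is
determined by finitely many evaluations. -/
lemma integrable_loss (hev : ∀ x : E d, Measurable (fun f : Density d => f x))
    (Q : Measure (Density d)) [IsProbabilityMeasure Q] {a m : ℝ} (ha : 0 < a) (hm : 0 < m)
    (ha1 : a ≤ 1) (hm1 : m ≤ 1) (δ lam : ℝ) (x : Fin n → E d) (C : SubPartition n) :
    Integrable (fun f : Density d => iaBinderLoss a a m m (surrogateClustering δ lam f x) C) Q := by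
  let _ : MeasurableSpace (Finset (Fin n)) := ⊤
  have hact : Measurable (fun f : Density d => activeSet f lam x) := by
    refine measurable_to_countable' fun A => ?_
    have : (fun f : Density d => activeSet f lam x) ⁻¹' {A} =
        ⋂ i, {f : Density d | lam ≤ f (x i) ↔ i ∈ A} := by
      ext f
      simp [activeSet, Finset.ext_iff]
    rw [this]
    refine MeasurableSet.iInter fun i => ?_
    by_cases hi : i ∈ A
    · simpa only [hi, iff_true] using measurableSet_le measurable_const (hev (x i))
    · simpa only [hi, iff_false, not_le] using measurableSet_lt (hev (x i)) measurable_const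
  let F : Finset (Fin n) → ℝ := fun A => iaBinderLoss a a m m
    ⟨A, Finpartition.ofSetSetoid (nbhdGraph δ x A).reachableSetoid A⟩ C
  have hF : Measurable fun f : Density d => F (activeSet f lam x) :=
    (measurable_from_top (f := F)).comp hact
  refine Integrable.of_bound (C := n * ((n : ℝ) - 1)) hF.aestronglyMeasurable
    (Eventually.of_forall fun f => ?_)
  rw [Real.norm_of_nonneg (iaBinderLoss_nonneg ha hm _ _)]
  exact iaBinderLoss_le ha1 hm1 _ _

/-- Integrating the triangle inequality over the posterior bounds the loss by the sum of the risks
of `C` and `C₀`, and the first risk is at most the second. -/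
lemma ballet_loss_le (hev : ∀ x : E d, Measurable (fun f : Density d => f x))
    (Q : Measure (Density d)) [IsProbabilityMeasure Q] {a m : ℝ} (ha : 0 < a) (ham : a ≤ 2 * m)
    (ha1 : a ≤ 1) (hm1 : m ≤ 1) {δ lam : ℝ} {x : Fin n → E d} {C : SubPartition n}
    (hC : IsBallet a a m m δ lam Q x C) (C₀ : SubPartition n) (S : Set (Density d)) {β : ℝ}
    (hβ : 0 ≤ β) (hS : ∀ f : Density d, f ∉ S →
      iaBinderLoss a a m m (surrogateClustering δ lam f x) C₀ ≤ β) :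
    iaBinderLoss a a m m C C₀ ≤ 2 * (β + n * ((n : ℝ) - 1) * Q.real S) := by
  have hm : 0 < m := by linarith
  have hint := integrable_loss hev Q ha hm ha1 hm1 δ lam x
  have h1 : iaBinderLoss a a m m C C₀ ≤ risk a a m m δ lam Q x C + risk a a m m δ lam Q x C₀ := by
    have hconst : iaBinderLoss a a m m C C₀ = ∫ _ : Density d, iaBinderLoss a a m m C C₀ ∂Q := by
      simp
    rw [hconst, risk, risk, ← integral_add (hint C) (hint C₀)]
    refine integral_mono (integrable_const _) ((hint C).add (hint C₀)) fun f => ?_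
    have := iaBinderLoss_triangle ha ham C (surrogateClustering δ lam f x) C₀
    rwa [iaBinderLoss_comm C (surrogateClustering δ lam f x)] at this
  have hn : (0 : ℝ) ≤ n * ((n : ℝ) - 1) :=
    (iaBinderLoss_nonneg ha hm C C₀).trans (iaBinderLoss_le ha1 hm1 C C₀)
  have h2 : risk a a m m δ lam Q x C₀ ≤ β + n * ((n : ℝ) - 1) * Q.real S := by
    -- `S` will be a sup-norm condition over uncountably many points and need not be measurable; its
    -- measurable hull has the same mass.
    have hU : MeasurableSet (toMeasurable Q S) := measurableSet_toMeasurable Q S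
    have hi : Integrable ((toMeasurable Q S).indicator fun _ => n * ((n : ℝ) - 1)) Q :=
      (integrable_const _).indicator hU
    have hval : ∫ f, (β + (toMeasurable Q S).indicator (fun _ => n * ((n : ℝ) - 1)) f) ∂Q =
        β + n * ((n : ℝ) - 1) * Q.real S := by
      rw [integral_add (integrable_const _) hi, integral_indicator hU]
      simp only [integral_const, probReal_univ, measureReal_restrict_apply_univ, smul_eq_mul]
      rw [measureReal_def Q (toMeasurable Q S), measure_toMeasurable, ← measureReal_def]
      ring
    rw [← hval, risk]
    refine integral_mono (hint C₀) ((integrable_const _).add hi) fun f => ?_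
    simp only
    by_cases hf : f ∈ toMeasurable Q S
    · rw [Set.indicator_of_mem hf]
      exact (iaBinderLoss_le ha1 hm1 _ _).trans (by linarith)
    · rw [Set.indicator_of_notMem hf, add_zero]
      exact hS f fun h => hf (subset_toMeasurable Q S h)
  linarith [hC C₀]

/-- Choose `K n = η / (ε n + 1 / (n + 1))`: it diverges and `ε n * K n ≤ η`. The summand `1 / (n +
1)` guards against `ε n = 0`. -/
lemma PosteriorContracts.tendsto_measure {Ω : Type*} [MeasurableSpace Ω] {P : Measure Ω}
    {X : ℕ → Ω → E d} {post : (n : ℕ) → (Fin n → E d) → Measure (Density d)} {f₀ : Density d}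
    [∀ n x, IsProbabilityMeasure (post n x)]
    (h : PosteriorContracts P X post f₀) {η κ : ℝ} (hη : 0 < η) (hκ : 0 < κ) :
    Tendsto (fun n => P {ω | κ ≤ (post n (sample X n ω)).real
      {f : Density d | ENNReal.ofReal η ≤ supDist f f₀}}) atTop (𝓝 0) := by
  obtain ⟨ε, hε0, hε, hK⟩ := h
  have hden : ∀ n : ℕ, 0 < ε n + 1 / ((n : ℝ) + 1) := fun n =>
    add_pos_of_nonneg_of_pos (hε0 n) (by positivity)
  have hden0 : Tendsto (fun n : ℕ => ε n + 1 / ((n : ℝ) + 1)) atTop (𝓝[>] 0) := by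
    refine tendsto_nhdsWithin_iff.2 ⟨?_, Eventually.of_forall hden⟩
    simpa using hε.add tendsto_one_div_add_atTop_nhds_zero_nat
  have h1 := hK (fun n => η * (ε n + 1 / ((n : ℝ) + 1))⁻¹)
    (fun n => mul_nonneg hη.le (inv_nonneg.2 (hden n).le))
    ((tendsto_inv_nhdsGT_zero.comp hden0).const_mul_atTop hη)
  rw [tendstoInMeasure_iff_norm] at h1
  refine tendsto_of_tendsto_of_tendsto_of_le_of_le tendsto_const_nhds (h1 κ hκ)
    (fun _ => zero_le) fun n => measure_mono fun ω hω => ?_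
  simp only [Set.mem_ofPred_eq, sub_zero] at hω ⊢
  rw [Real.norm_of_nonneg measureReal_nonneg]
  refine hω.trans (measureReal_mono fun f hf => le_trans (ENNReal.ofReal_le_ofReal ?_) hf)
  rw [mul_left_comm]
  refine mul_le_of_le_one_right hη.le ?_
  rw [← div_eq_mul_inv, div_le_one (hden n)]
  exact le_add_of_nonneg_right (by positivity)

end Estimate

/-! ### Consistency -/

section Consistency

variable {d : ℕ} [MeasurableSpace (Density d)]

/-- On data with few points near the level, good coverage, an admissible scale and a concentrated
posterior, the normalized loss of the BALLET estimate is small. -/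
lemma normalized_loss_lt {n : ℕ} (hn : 2 ≤ n) {f₀ : Density d} {lam e η δ δbar ρ t ε s : ℝ}
    (hstab : StableComponents f₀ lam e) (he : 0 < e)
    (hmod : ∀ y z, dist y z < δbar → |f₀ y - f₀ z| < e / 2)
    (hη : 0 < η) (hηe : 2 * η ≤ e / 2) (hδ : δ ≤ δbar) (ht : 0 < t) {x : Fin n → E d}
    (hρ : (activeSet f₀ lam x).Nonempty → 2 * ρ + t ≤ δ)
    (hmodρ : ∀ y z, dist y z < ρ → |f₀ y - f₀ z| < η)
    (hcov : ∀ z, lam ≤ f₀ z → ∃ i, dist (x i) z < ρ)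
    (hev : ∀ x : E d, Measurable (fun f : Density d => f x))
    {Q : Measure (Density d)} [IsProbabilityMeasure Q] {a m : ℝ} (ha : 0 < a) (ham : a ≤ 2 * m)
    (ha1 : a ≤ 1) (hm1 : m ≤ 1) {C : SubPartition n} (hC : IsBallet a a m m δ lam Q x C)
    (hQ : Q.real {f : Density d | ENNReal.ofReal η ≤ supDist f f₀} < ε / 16)
    (hs : s ≤ ε / 32)
    (hstrip : |((stripSet f₀ lam (2 * η) x).card : ℝ) / n - s| < ε / 32) :
    |((n.choose 2 : ℝ))⁻¹ * iaBinderLoss a a m m C (levelClustering lam f₀ x)| < ε := by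
  have hn' : (2 : ℝ) ≤ n := by exact_mod_cast hn
  have hm : 0 < m := by linarith
  have hloss := ballet_loss_le hev Q ha ham ha1 hm1 hC (levelClustering lam f₀ x)
    {f : Density d | ENNReal.ofReal η ≤ supDist f f₀}
    (β := ((n : ℝ) - 1) * (2 * (stripSet f₀ lam (2 * η) x).card))
    (mul_nonneg (by linarith) (by positivity)) fun f hf =>
      surrogate_loss_le ha1 hm1 hstab he hmod hη hηe
        (abs_sub_lt_of_supDist_lt (not_le.1 hf)) hδ ht hρ hmodρ hcov
  set B : ℝ := ((stripSet f₀ lam (2 * η) x).card : ℝ) with hB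
  set q := Q.real {f : Density d | ENNReal.ofReal η ≤ supDist f f₀} with hq
  have h1 := (abs_lt.1 hstrip).2
  have hq0 : 0 ≤ q := measureReal_nonneg
  rw [abs_of_nonneg (mul_nonneg (by positivity) (iaBinderLoss_nonneg ha hm _ _)),
    Nat.cast_choose_two]
  have hpos : 0 < (n : ℝ) * ((n : ℝ) - 1) / 2 := by
    have : (0 : ℝ) < n - 1 := by linarith
    positivity
  rw [inv_mul_lt_iff₀ hpos]
  refine hloss.trans_lt ?_
  -- Here `B / n < ε / 16` and `q < ε / 16`, so the last factor is below `3 * ε / 4`.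
  have heq : 2 * (((n : ℝ) - 1) * (2 * B) + n * ((n : ℝ) - 1) * q) =
      n * ((n : ℝ) - 1) / 2 * (8 * (B / n) + 4 * q) := by
    field_simp
    ring
  rw [heq]
  exact mul_lt_mul_of_pos_left (by linarith) hpos

end Consistency

/-- Bernoulli's inequality. Shrinking the radius by the factor `1 - 1 / (2 * d)` costs at most half
the volume and leaves room for the net spacing and for the step `t` of the chaining. -/
lemma half_le_one_sub_pow {d : ℕ} (hd : 1 ≤ d) :
    (0 : ℝ) < 1 / (2 * d) ∧ (1 : ℝ) / (2 * d) < 1 ∧ 1 / 2 ≤ (1 - (1 : ℝ) / (2 * d)) ^ d := by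
  have hd' : (1 : ℝ) ≤ d := by exact_mod_cast hd
  have h1 : (1 : ℝ) / (2 * d) < 1 := by
    rw [div_lt_one (by positivity)]; linarith
  refine ⟨by positivity, h1, ?_⟩
  have h := one_add_mul_le_pow (a := -((1 : ℝ) / (2 * d))) (by linarith) d
  rw [← sub_eq_add_neg] at h
  refine le_trans (le_of_eq ?_) h
  field_simp
  norm_num

end Ballet

end

theorem mainTheorem5 {d : ℕ} (hd : 1 ≤ d) (f₀ : Ballet.Density d) (lam : ℝ) (hlam : 0 < lam)
    (hcont : Continuous f₀) (hvanish : Tendsto f₀ (cocompact (Ballet.E d)) (𝓝 0))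
    (hreg : ∃ C εbar : ℝ, 0 < C ∧ 0 < εbar ∧
      Ballet.FastMassDecay f₀ lam C εbar ∧ Ballet.StableComponents f₀ lam εbar) :
    ∃ δbar : ℝ, 0 < δbar ∧
      ∀ (Ω : Type*) [MeasurableSpace Ω] (P : Measure Ω) [IsProbabilityMeasure P]
        (X : ℕ → Ω → Ballet.E d)
        (_ : ∀ i, HasLaw (X i) f₀.law P) (_ : iIndepFun X P)
        [MeasurableSpace (Ballet.Density d)]
        (_ : ∀ x : Ballet.E d, Measurable (fun f : Ballet.Density d => f x))
        (post : (n : ℕ) → (Fin n → Ballet.E d) → Measure (Ballet.Density d))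
        (_ : ∀ n x, IsProbabilityMeasure (post n x))
        (_ : Ballet.PosteriorContracts P X post f₀)
        (a b mai mia : ℝ) (_ : 0 < a) (_ : a = b) (_ : a ≤ 1)
        (_ : mai = mia) (_ : mai ≤ 1) (_ : a ≤ 2 * mai)
        (δ : (n : ℕ) → (Fin n → Ballet.E d) → ℝ)
        (_ : Ballet.DeterministicScale lam δbar δ ∨ Ballet.AdaptiveScale P X f₀ lam δ)
        (est : (n : ℕ) → (Fin n → Ballet.E d) → Ballet.SubPartition n)
        (_ : ∀ n x, Ballet.IsBallet a b mai mia (δ n x) lam (post n x) x (est n x)),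
        TendstoInMeasure P
          (fun n ω => ((n.choose 2 : ℝ))⁻¹ *
            Ballet.iaBinderLoss a b mai mia (est n (Ballet.sample X n ω))
              (Ballet.levelClustering lam f₀ (Ballet.sample X n ω)))
          atTop (fun _ => (0 : ℝ)) := by
  obtain ⟨C, e, hC, he, hdecay, hstab⟩ := hreg
  -- `δbar` is a modulus of continuity of `f₀` for half the stability range, so it is fixed before
  -- the data and the model.
  obtain ⟨δbar, hδbar, hmod⟩ := Ballet.exists_modulus hcont hvanish (half_pos he)
  refine ⟨δbar, hδbar, ?_⟩
  intro Ω _ P _ X hX hind _ hev post hpost hcontr a b m mia ha hab ha1 hmm hm1 ham δ hδ est hest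
  subst hab hmm
  obtain ⟨hτ, hτ1, hτd⟩ := Ballet.half_le_one_sub_pow hd
  set τ : ℝ := 1 / (2 * d) with hτdef
  rw [tendstoInMeasure_iff_norm]
  intro ε hε
  -- `e / 4` keeps the levels used within the stable range; `ε / (64 * C)` makes the mass of the
  -- strip of half-width `2 * η` at most `ε / 32`.
  set η : ℝ := min (e / 4) (ε / (64 * C)) with hηdef
  have hη : 0 < η := lt_min (by positivity) (by positivity)
  have hηe : η ≤ e / 4 := min_le_left _ _
  have hηC : C * (2 * η) ≤ ε / 32 := by
    have h1 : η ≤ ε / (64 * C) := min_le_right _ _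
    rw [le_div_iff₀ (by positivity)] at h1
    linarith
  obtain ⟨ρ, hρ, hmodρ⟩ := Ballet.exists_modulus hcont hvanish hη
  have hs := (Ballet.law_strip_le f₀ hdecay (by positivity : 0 < 2 * η) (by linarith)).trans hηC
  have hlim := (((Ballet.tendstoInMeasure_count hX hind (Ballet.measurableSet_strip f₀ lam (2 * η))
    (by positivity : 0 < ε / 32)).add
    (hcontr.tendsto_measure hη (by positivity : 0 < ε / 16))).add
    (Ballet.tendsto_measure_uncovered hd hlam hcont hvanish hX hind hτ hτ1 hτd)).add
    (Ballet.tendsto_measure_bad_scale hd hlam hcont hvanish hX hind hδbar hδ)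
  simp only [add_zero] at hlim
  refine tendsto_of_tendsto_of_tendsto_of_le_of_le' tendsto_const_nhds hlim
    (Eventually.of_forall fun _ => zero_le) ?_
  filter_upwards [eventually_ge_atTop 2,
    (Ballet.tendsto_rLower (lam := lam) hd).eventually_lt_const hρ] with n hn hrρ
  refine le_trans (measure_mono ?_) ((measure_union_le _ _).trans (add_le_add_left
    ((measure_union_le _ _).trans (add_le_add_left (measure_union_le _ _) _)) _))
  intro ω hω
  by_contra hnot
  rw [Set.mem_union, Set.mem_union, Set.mem_union, not_or, not_or, not_or] at hnot
  obtain ⟨⟨⟨h1, h2⟩, h3⟩, h4⟩ := hnot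
  obtain ⟨h4, h5⟩ := not_not.1 h4
  simp only [Set.mem_ofPred_eq, not_exists, not_and, not_forall, not_not, not_le] at h2 h3
  simp only [Set.mem_ofPred_eq, sub_zero, Real.norm_eq_abs] at hω
  have hr := Ballet.rLower_pos hd hlam hn
  refine absurd hω (not_le.2 (Ballet.normalized_loss_lt hn hstab he hmod hη (by linarith) h4
    (t := τ * (Ballet.rLower n d lam / 2)) (by positivity) (fun hne => le_trans (le_of_eq ?_)
    (h5 hne)) (fun y z hyz => hmodρ y z (hyz.trans ?_)) h3 hev ha ham ha1 hm1 (hest n _) h2 hs ?_))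
  -- Twice the covering radius `(1 - τ / 2) * r_n / 2` plus the step `τ * r_n / 2` is exactly `r_n`.
  · ring
  · nlinarith
  · have hstrip : Ballet.stripSet f₀ lam (2 * η) (Ballet.sample X n ω) = Finset.univ.filter
        (fun i => Ballet.sample X n ω i ∈ {y | |f₀ y - lam| ≤ 2 * η}) := by
      ext i
      simp [Ballet.stripSet]
    rw [hstrip]
    exact not_le.1 h1
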